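/- **Setting.** All logarithms are natural. For a probability law of $X$ on $\mathbb{R}$, $H(X)\in[0,\infty]$ denotes its Shannon entropy: $\sum_i p_i\log(1/p_i)$ if $X$ is discrete with atoms of probabilities $p_i$, and $H(X)=\infty$ if $X$ is not discrete. For $\mathsf{snr}>0$ let $Z\sim\mathcal N(0,1/\mathsf{snr})$ be independent of $X$, let $I(X;X+Z)$ be the mutual information, and let $$C_H(h,\mathsf{snr})=\sup\{I(X;X+Z): \mathbb{E}[X^2]\le 1,\ H(X)\le h\}.$$ Within a class of input laws, a member $X^*$ is called *optimal as $\mathsf{snr}\to\infty$* if for every member $X$ of the class there is $\mathsf{snr}_0>0$ such that $I(X^*;X^*+Z)\ge I(X;X+Z)$ for all $\mathsf{snr}>\mathsf{snr}_0$. For $\lambda>0$ let $L(\lambda)=\log\sum_{j\in\mathbb Z}e^{-\lambda j^2}$. For $\beta>0$ let $\mathcal N^{\mathrm{disc}}_\beta(\lambda)$ be the law on the lattice $\beta\mathbb{Z}$ with mass $e^{-L(\lambda)-\lambda i^2}$ at $\beta i$, $i\in\mathbb Z$. **Theorem.** The series defining $L$ converges, $L$ is differentiable and $L'<0$ on $(0,\infty)$.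 Let $0<h<\infty$. There is exactly one $\lambda_h>0$ with $h=L(\lambda_h)-\lambda_hL'(\lambda_h)$. Put $d_h=1/\sqrt{-L'(\lambda_h)}$. Then: 1. Among the inputs with $\mathbb{E}[X^2]=1$ and $H(X)=h$, the law $\mathcal N^{\mathrm{disc}}_{d_h}(\lambda_h)$ is the unique one that is optimal as $\mathsf{snr}\to\infty$. It is also the unique optimal one among the inputs with $\mathbb{E}[X^2]\le1$ and $H(X)\le h$. 2. As $\mathsf{snr}\to\infty$, with an implied constant that may depend on $h$, $$C_H(h,\mathsf{snr})=h-O\!\left(\exp\!\left(-\mathsf{snr}\,\frac{d_h^2}{8}\right)\right).$$ -/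

import Mathlib

open MeasureTheory ProbabilityTheory Filter Asymptotics
open scoped ENNReal

noncomputable section

/-- The Shannon entropy (in nats) of a probability law `P` on `ℝ`: the sum of `p log (1/p)` over
the atoms when `P` is discrete, that is, carried by a countable set, and `∞` otherwise. -/
def entropy (P : Measure ℝ) : ℝ≥0∞ :=
  open Classical in
  if ∃ s : Set ℝ, s.Countable ∧ P sᶜ = 0 then
    ∑' x : ℝ, ENNReal.ofReal (Real.negMulLog (P.real {x}))
  else ∞

/-- The second moment `E[X²]` of a law `P` on `ℝ`. -/
def secondMoment (P : Measure ℝ) : ℝ≥0∞ :=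
  ∫⁻ x, ENNReal.ofReal (x ^ 2) ∂P

/-- The mutual information `I(X; Y)` (in nats): the relative entropy of the joint law with respect
to the product of the marginal laws. -/
def mutualInfo {Ω : Type*} [MeasurableSpace Ω] (μ : Measure Ω) (X Y : Ω → ℝ) : ℝ≥0∞ :=
  InformationTheory.klDiv (μ.map fun ω => (X ω, Y ω)) ((μ.map X).prod (μ.map Y))

/-- `I(X; X + Z)` for `X ∼ P` and an independent `Z ∼ N(0, 1 / snr)`. -/
def gaussianChannelInfo (snr : ℝ) (P : Measure ℝ) : ℝ≥0∞ :=
  mutualInfo (P.prod (gaussianReal 0 (1 / snr).toNNReal))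
    (fun ω : ℝ × ℝ => ω.1) (fun ω : ℝ × ℝ => ω.1 + ω.2)

/-- The input laws with `E[X²] ≤ 1` and `H(X) ≤ h`. -/
def inputsLE (h : ℝ) : Set (Measure ℝ) :=
  {P | IsProbabilityMeasure P ∧ secondMoment P ≤ 1 ∧ entropy P ≤ ENNReal.ofReal h}

/-- The input laws with `E[X²] = 1` and `H(X) = h`. -/
def inputsEq (h : ℝ) : Set (Measure ℝ) :=
  {P | IsProbabilityMeasure P ∧ secondMoment P = 1 ∧ entropy P = ENNReal.ofReal h}

/-- The entropy-constrained capacity `C_H(h, snr)`, the supremum of `I(X; X + Z)` over all inputs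
with `E[X²] ≤ 1` and `H(X) ≤ h`. -/
def entropyCapacity (h snr : ℝ) : ℝ≥0∞ :=
  ⨆ P ∈ inputsLE h, gaussianChannelInfo snr P

/-- `Q` is optimal as `snr → ∞` within the class `S` of input laws: it belongs to `S`, and against
every member `P` of `S` it is at least as good for all `snr` beyond a threshold, which may depend
on `P`. -/
def IsOptimalAtHighSNR (S : Set (Measure ℝ)) (Q : Measure ℝ) : Prop :=
  Q ∈ S ∧ ∀ P ∈ S, ∃ snr₀ : ℝ, 0 < snr₀ ∧
    ∀ snr : ℝ, snr₀ < snr → gaussianChannelInfo snr P ≤ gaussianChannelInfo snr Q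

/-- `L(l) = log ∑_{j ∈ ℤ} exp (- l j²)`. -/
def logTheta (l : ℝ) : ℝ :=
  Real.log (∑' j : ℤ, Real.exp (-l * (j : ℝ) ^ 2))

/-- The discrete Gaussian law on the lattice `β ℤ`, with mass `exp (- L(l) - l i²)` at `β i`. -/
def discreteGaussian (β l : ℝ) : Measure ℝ :=
  Measure.sum fun i : ℤ =>
    ENNReal.ofReal (Real.exp (-logTheta l - l * (i : ℝ) ^ 2)) • Measure.dirac (β * (i : ℝ))

end

open scoped NNReal

/-! For discrete `X` one has `I(X; X + Z) = H(X) - H(X | X + Z)`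
(`gaussianChannelInfo_add_equivocation`, stated without subtraction). At high snr the equivocation
of the discrete Gaussian law vanishes, so entropy decides first and the decay rate of the
equivocation decides among inputs of equal entropy.

That rate is governed by the distance between atoms. Two atoms closer than `d` keep the equivocation
above `c exp (-snr κ)` with `κ < d² / 8` (`exists_exp_le_equivocation`), whereas the discrete
Gaussian law of spacing `d` has equivocation `O (exp (-snr d² / 8))`
(`equivocation_discreteGaussian_le`). The latter bound also gives the capacity asymptotics, since
`C_H ≤ h`.

It remains to see that `d_h`-separated atoms, second moment at most `1` and entropy `h` force the
discrete Gaussian law (`eq_discreteGaussian_of_separated`). This is Gibbs' inequality against the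
weights `exp (-L(λ) - λ (x / d_h)²)` on the atoms `x`. Their total is at most `1` because, among
`1`-separated sets, the integers have the largest Gaussian sum: sliding the points towards the
origin puts them in a translate of `ℤ`, and Poisson summation shows that non-integer translates have
strictly smaller sums.

The parameter `λ_h` exists and is unique because `L` is strictly convex, which makes `L - λ L'`
strictly decreasing, and because this function takes values on both sides of `h`. -/

/-! ### The theta sum, convexity of its logarithm, and the equation for `λ_h` -/

theorem summable_abs_pow_mul_exp_neg_mul_sq {l : ℝ} (hl : 0 < l) (k : ℕ) :
    Summable fun j : ℤ => |(j : ℝ)| ^ k * Real.exp (-l * (j : ℝ) ^ 2) := by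
  have h := summable_pow_mul_jacobiTheta₂_term_bound 0 (T := l / Real.pi) (by positivity) k
  refine h.congr fun j => ?_
  congr 2
  · push_cast; rfl
  · field_simp
    ring

theorem summable_exp_neg_mul_sq {l : ℝ} (hl : 0 < l) :
    Summable fun j : ℤ => Real.exp (-l * (j : ℝ) ^ 2) := by
  simpa using summable_abs_pow_mul_exp_neg_mul_sq hl 0

theorem summable_sq_mul_exp_neg_mul_sq {l : ℝ} (hl : 0 < l) :
    Summable fun j : ℤ => (j : ℝ) ^ 2 * Real.exp (-l * (j : ℝ) ^ 2) := by
  simpa using summable_abs_pow_mul_exp_neg_mul_sq hl 2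

/-- `∑ exp (- l j²)` over the integers. -/
noncomputable def thetaSum (l : ℝ) : ℝ := ∑' j : ℤ, Real.exp (-l * (j : ℝ) ^ 2)

/-- `∑ j² exp (- l j²)` over the integers. -/
noncomputable def thetaSumSq (l : ℝ) : ℝ :=
  ∑' j : ℤ, (j : ℝ) ^ 2 * Real.exp (-l * (j : ℝ) ^ 2)

theorem one_le_thetaSum {l : ℝ} (hl : 0 < l) : 1 ≤ thetaSum l := by
  have := (summable_exp_neg_mul_sq hl).le_tsum 0 (fun j _ => (Real.exp_pos _).le)
  simpa [thetaSum] using this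

theorem thetaSum_pos {l : ℝ} (hl : 0 < l) : 0 < thetaSum l :=
  zero_lt_one.trans_le (one_le_thetaSum hl)

theorem thetaSumSq_pos {l : ℝ} (hl : 0 < l) : 0 < thetaSumSq l :=
  (summable_sq_mul_exp_neg_mul_sq hl).tsum_pos (fun j => by positivity) 1 (by simp [Real.exp_pos])

theorem logTheta_nonneg {l : ℝ} (hl : 0 < l) : 0 ≤ logTheta l :=
  Real.log_nonneg (one_le_thetaSum hl)

theorem hasDerivAt_thetaSum {l : ℝ} (hl : 0 < l) : HasDerivAt thetaSum (-thetaSumSq l) l := by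
  have hl2 : 0 < l / 2 := by positivity
  have := hasDerivAt_tsum_of_isPreconnected (t := Set.Ioi (l / 2))
    (g := fun (j : ℤ) y => Real.exp (-y * (j : ℝ) ^ 2))
    (g' := fun (j : ℤ) y => -((j : ℝ) ^ 2 * Real.exp (-y * (j : ℝ) ^ 2)))
    (summable_sq_mul_exp_neg_mul_sq hl2) isOpen_Ioi isPreconnected_Ioi
    (fun j y _ => by
      have h1 : HasDerivAt (fun y : ℝ => -y * (j : ℝ) ^ 2) (-1 * (j : ℝ) ^ 2) y :=
        (hasDerivAt_id y).neg.mul_const _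
      exact h1.exp.congr_deriv (by ring))
    (fun j y hy => by
      rw [norm_neg, Real.norm_of_nonneg (by positivity)]
      have : l / 2 ≤ y := le_of_lt hy
      gcongr)
    (y₀ := l) (by simpa using hl) (summable_exp_neg_mul_sq hl) (y := l) (by simpa using hl)
  rw [tsum_neg] at this
  exact this

theorem continuousOn_thetaSumSq : ContinuousOn thetaSumSq (Set.Ioi 0) := by
  intro l hl
  have hl : 0 < l := hl
  have hl2 : 0 < l / 2 := by positivity
  have : ContinuousOn thetaSumSq (Set.Ioi (l / 2)) := by
    refine continuousOn_tsum (fun j => by fun_prop) (summable_sq_mul_exp_neg_mul_sq hl2) ?_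
    intro j y hy
    rw [Real.norm_of_nonneg (by positivity)]
    have : l / 2 ≤ y := le_of_lt hy
    gcongr
  exact (this.continuousAt (Ioi_mem_nhds (by linarith))).continuousWithinAt

theorem hasDerivAt_logTheta {l : ℝ} (hl : 0 < l) :
    HasDerivAt logTheta (-(thetaSumSq l / thetaSum l)) l := by
  have := (hasDerivAt_thetaSum hl).log (thetaSum_pos hl).ne'
  rw [neg_div] at this
  exact this

theorem deriv_logTheta {l : ℝ} (hl : 0 < l) :
    deriv logTheta l = -(thetaSumSq l / thetaSum l) := (hasDerivAt_logTheta hl).deriv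

theorem deriv_logTheta_neg {l : ℝ} (hl : 0 < l) : deriv logTheta l < 0 := by
  rw [deriv_logTheta hl, neg_lt_zero]
  exact div_pos (thetaSumSq_pos hl) (thetaSum_pos hl)

theorem continuousOn_deriv_logTheta : ContinuousOn (deriv logTheta) (Set.Ioi 0) := by
  have h : ContinuousOn (fun l => -(thetaSumSq l / thetaSum l)) (Set.Ioi 0) :=
    (continuousOn_thetaSumSq.div
      (fun l hl => (hasDerivAt_thetaSum hl).continuousAt.continuousWithinAt)
      (fun l hl => (thetaSum_pos hl).ne')).neg
  exact h.congr fun l hl => deriv_logTheta hl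

/-- `logTheta` lies strictly above its tangents. -/
theorem logTheta_tangent_lt {l m : ℝ} (hl : 0 < l) (hm : 0 < m) (hne : m ≠ l) :
    logTheta l + deriv logTheta l * (m - l) < logTheta m := by
  have h0 := thetaSum_pos hl
  have h1 := thetaSumSq_pos hl
  set c := deriv logTheta l * (m - l) with hc
  have hc0 : c ≠ 0 := mul_ne_zero (deriv_logTheta_neg hl).ne (sub_ne_zero.2 hne)
  have key : Real.exp c * thetaSum l < thetaSum m := by
    -- Jensen's inequality by hand: `exp t ≥ 1 + t` is applied at `t = -(m - l) j² - c`, and `c` is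
    -- chosen so that `t` has mean zero under the weights `exp (-l j²)`. The term `j = 0`, where `t
    -- = -c ≠ 0`, makes it strict.
    have hs : HasSum (fun j : ℤ => Real.exp c * ((1 - c) * Real.exp (-l * (j : ℝ) ^ 2) -
        (m - l) * ((j : ℝ) ^ 2 * Real.exp (-l * (j : ℝ) ^ 2))))
        (Real.exp c * ((1 - c) * thetaSum l - (m - l) * thetaSumSq l)) :=
      (((summable_exp_neg_mul_sq hl).hasSum.mul_left _).sub
        ((summable_sq_mul_exp_neg_mul_sq hl).hasSum.mul_left _)).mul_left _
    have hv : Real.exp c * ((1 - c) * thetaSum l - (m - l) * thetaSumSq l)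
        = Real.exp c * thetaSum l := by
      have : c * thetaSum l = -((m - l) * thetaSumSq l) := by
        rw [hc, deriv_logTheta hl]; field_simp
      congr 1; linarith
    rw [hv] at hs
    have e (j : ℤ) : Real.exp (-m * (j : ℝ) ^ 2) =
        Real.exp c * (Real.exp (-l * (j : ℝ) ^ 2) * Real.exp (-(m - l) * (j : ℝ) ^ 2 - c)) := by
      rw [← Real.exp_add, ← Real.exp_add]; congr 1; ring
    refine hasSum_lt (i := 0) (fun j => ?_) ?_ hs (summable_exp_neg_mul_sq hm).hasSum
    · dsimp only
      rw [e]
      have := Real.add_one_le_exp (-(m - l) * (j : ℝ) ^ 2 - c)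
      refine mul_le_mul_of_nonneg_left ?_ (Real.exp_pos _).le
      have := mul_le_mul_of_nonneg_left this (Real.exp_pos (-l * (j : ℝ) ^ 2)).le
      linarith
    · have := Real.add_one_lt_exp (neg_ne_zero.2 hc0)
      rw [e]
      refine mul_lt_mul_of_pos_left ?_ (Real.exp_pos _)
      simp
      linarith
  have := Real.log_lt_log (by positivity) key
  rw [Real.log_mul (Real.exp_pos _).ne' h0.ne', Real.log_exp] at this
  change Real.log (thetaSum l) + c < Real.log (thetaSum m)
  linarith

/-- The function is the height at `0` of the tangent at `l`. Adding the tangent inequalities at two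
points shows that the derivative increases; one of them then compares the heights. -/
theorem strictAntiOn_logTheta_sub :
    StrictAntiOn (fun l => logTheta l - l * deriv logTheta l) (Set.Ioi 0) := by
  intro l hl m hm hlm
  have hl : 0 < l := hl
  have hm : 0 < m := hm
  have h1 := logTheta_tangent_lt hl hm hlm.ne'
  have h2 := logTheta_tangent_lt hm hl hlm.ne
  dsimp only
  have h3 : deriv logTheta l < deriv logTheta m := by nlinarith
  nlinarith

theorem logTheta_lt_of_large {ε : ℝ} (hε : 0 < ε) : ∃ m : ℝ, 0 < m ∧ logTheta m < ε := by
  have hT := one_le_thetaSum one_pos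
  -- For `j ≠ 0`, `j² ≥ 1` gives `m j² ≥ (m - 1) + j²`, which factors out a decaying constant.
  have hbound : ∀ m : ℝ, 1 ≤ m → thetaSum m ≤ 1 + Real.exp (-(m - 1)) * thetaSum 1 := by
    intro m hm
    have hs : HasSum (fun j : ℤ => (if j = 0 then (1 : ℝ) else 0) +
        Real.exp (-(m - 1)) * Real.exp (-1 * (j : ℝ) ^ 2))
        (1 + Real.exp (-(m - 1)) * thetaSum 1) :=
      (hasSum_ite_eq 0 1).add ((summable_exp_neg_mul_sq one_pos).hasSum.mul_left _)
    refine hasSum_le (fun j => ?_) (summable_exp_neg_mul_sq (by linarith : 0 < m)).hasSum hs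
    by_cases hj : j = 0
    · subst hj; simp; positivity
    · rw [if_neg hj, zero_add, ← Real.exp_add]
      have hj1 : (1 : ℝ) ≤ (j : ℝ) ^ 2 := by
        exact_mod_cast Int.one_le_abs (pow_ne_zero 2 hj) |>.trans_eq (abs_of_nonneg (sq_nonneg j))
      refine Real.exp_le_exp.2 ?_
      nlinarith
  have ht : Tendsto (fun m : ℝ => 1 + Real.exp (-(m - 1)) * thetaSum 1) atTop (nhds 1) := by
    have : Tendsto (fun m : ℝ => Real.exp (-(m - 1))) atTop (nhds 0) :=
      Real.tendsto_exp_neg_atTop_nhds_zero.comp (tendsto_atTop_add_const_right _ (-1) tendsto_id)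
    simpa using (this.mul_const (thetaSum 1)).const_add 1
  obtain ⟨m, hm, hm1⟩ := ((ht.eventually (gt_mem_nhds (Real.one_lt_exp_iff.2 hε))).and
    (eventually_ge_atTop 1)).exists
  refine ⟨m, by linarith, ?_⟩
  rw [← Real.log_exp ε]
  exact Real.log_lt_log (thetaSum_pos (by linarith)) ((hbound m hm1).trans_lt hm)

theorem logTheta_gt_of_small (B : ℝ) : ∃ l : ℝ, 0 < l ∧ B < logTheta l := by
  obtain ⟨N, hN⟩ := exists_nat_gt (2 * Real.exp B)
  have hN0 : (0 : ℝ) < N := by have := Real.exp_pos B; linarith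
  -- With this parameter each of the terms `j = 0, …, N - 1` is at least `1 / 2`.
  have hl : 0 < Real.log 2 / N ^ 2 := by have := Real.log_pos one_lt_two; positivity
  refine ⟨Real.log 2 / N ^ 2, hl, ?_⟩
  rw [← Real.log_exp B]
  refine Real.log_lt_log (Real.exp_pos _) ?_
  have h1 := (summable_exp_neg_mul_sq hl).sum_le_tsum
    ((Finset.range N).map Nat.castEmbedding) (fun j _ => (Real.exp_pos _).le)
  refine lt_of_lt_of_le ?_ h1
  rw [Finset.sum_map]
  have h2 : ∑ _i ∈ Finset.range N, (1 / 2 : ℝ) ≤ ∑ i ∈ Finset.range N,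
      Real.exp (-(Real.log 2 / N ^ 2) * (((Nat.castEmbedding i : ℤ)) : ℝ) ^ 2) := by
    refine Finset.sum_le_sum fun i hi => ?_
    have hi : (i : ℝ) ≤ N := by exact_mod_cast (Finset.mem_range.1 hi).le
    have : (1 / 2 : ℝ) = Real.exp (-(Real.log 2 / N ^ 2) * N ^ 2) := by
      rw [neg_mul, div_mul_cancel₀ _ (by positivity), Real.exp_neg, Real.exp_log two_pos]
      norm_num
    rw [this]
    refine Real.exp_le_exp.2 ?_
    simp only [Nat.castEmbedding_apply, Int.cast_natCast, neg_mul, neg_le_neg_iff]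
    gcongr
  refine lt_of_lt_of_le ?_ h2
  simp
  linarith

theorem exists_eq_logTheta_sub {h : ℝ} (hh : 0 < h) :
    ∃ l : ℝ, 0 < l ∧ h = logTheta l - l * deriv logTheta l := by
  obtain ⟨l₁, hl₁, h₁⟩ := logTheta_gt_of_small h
  obtain ⟨m, hm, h₂⟩ := logTheta_lt_of_large (ε := h / 3) (by positivity)
  have hg₁ : h ≤ logTheta l₁ - l₁ * deriv logTheta l₁ := by
    nlinarith [deriv_logTheta_neg hl₁]
  -- The tangent at `2m`, evaluated at `m`, gives `L(2m) - m L'(2m) < L(m) < h / 3`. Doubling and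
  -- using `L(2m) ≥ 0` bounds the left side by `2h / 3`.
  have hg₂ : logTheta (2 * m) - 2 * m * deriv logTheta (2 * m) ≤ h := by
    have h3 := logTheta_tangent_lt (l := 2 * m) (m := m) (by positivity) hm (by linarith)
    have h4 := logTheta_nonneg (l := 2 * m) (by positivity)
    linarith
  have hc : ContinuousOn (fun l => logTheta l - l * deriv logTheta l) (Set.Ioi 0) :=
    ContinuousOn.sub
      (fun l hl => (hasDerivAt_logTheta hl).continuousAt.continuousWithinAt)
      (continuousOn_id.mul continuousOn_deriv_logTheta)
  obtain ⟨l, hl, e⟩ := isPreconnected_Ioi.intermediate_value (a := 2 * m) (b := l₁)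
    (Set.mem_Ioi.2 (by positivity)) hl₁ hc ⟨hg₂, hg₁⟩
  exact ⟨l, hl, e.symm⟩

/-! ### Gaussian sums over translates of `ℤ` and over separated families -/

theorem summable_exp_neg_mul_add_sq {l : ℝ} (hl : 0 < l) (s : ℝ) :
    Summable fun j : ℤ => Real.exp (-l * ((j : ℝ) + s) ^ 2) := by
  have h := summable_pow_mul_jacobiTheta₂_term_bound (l * |s| / Real.pi) (T := l / Real.pi)
    (by positivity) 0
  refine Summable.of_nonneg_of_le (fun j => (Real.exp_pos _).le) (fun j => ?_) h
  rw [pow_zero, one_mul]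
  refine Real.exp_le_exp.2 ?_
  have e : -Real.pi * (l / Real.pi * (j : ℝ) ^ 2 - 2 * (l * |s| / Real.pi) * (|j| : ℤ)) =
      -l * ((j : ℝ) ^ 2 - 2 * |s| * |(j : ℝ)|) := by
    push_cast
    field_simp
  rw [e]
  have : -(|s| * |(j : ℝ)|) ≤ j * s := by
    rw [← abs_mul, mul_comm]; exact neg_abs_le _
  nlinarith [sq_nonneg s]

/-- A translate of the integer lattice by a non-integer has a smaller Gaussian sum. -/
theorem tsum_exp_neg_mul_add_sq_lt {l : ℝ} (hl : 0 < l) {s : ℝ} (hs : s ∉ Set.range ((↑) : ℤ → ℝ)) :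
    ∑' j : ℤ, Real.exp (-l * ((j : ℝ) + s) ^ 2) < thetaSum l := by
  set a : ℝ := Real.pi / l with ha
  have ha0 : 0 < a := div_pos Real.pi_pos hl
  -- Poisson summation turns the translate by `s` into a cosine series with positive coefficients,
  -- which is largest when every cosine is `1`. The term `n = 1` is strictly smaller unless `s` is
  -- an integer.
  have poisson (s : ℝ) : HasSum
      (fun n : ℤ => Real.exp (-(Real.pi * a) * (n : ℝ) ^ 2) * Real.cos (2 * Real.pi * s * n))
      (1 / a ^ (1 / 2 : ℝ) * ∑' j : ℤ, Real.exp (-l * ((j : ℝ) + s) ^ 2)) := by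
    have h := Complex.tsum_exp_neg_quadratic (a := a) (by simpa using ha0) (-(Complex.I * s))
    have hre (n : ℤ) : (Complex.exp (-Real.pi * a * n ^ 2 + 2 * Real.pi * -(Complex.I * s) * n)).re
        = Real.exp (-(Real.pi * a) * (n : ℝ) ^ 2) * Real.cos (2 * Real.pi * s * n) := by
      have : (-Real.pi * a * n ^ 2 + 2 * Real.pi * -(Complex.I * s) * n : ℂ) =
          ((-(Real.pi * a) * (n : ℝ) ^ 2 : ℝ) : ℂ) +
            ((-(2 * Real.pi * s * n) : ℝ) : ℂ) * Complex.I := by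
        push_cast; ring
      rw [this, Complex.exp_add, ← Complex.ofReal_exp, Complex.re_ofReal_mul,
        Complex.exp_ofReal_mul_I_re, Real.cos_neg]
    have hsum : Summable fun n : ℤ =>
        Complex.exp (-Real.pi * a * n ^ 2 + 2 * Real.pi * -(Complex.I * s) * n) := by
      refine Summable.of_norm ?_
      refine (summable_exp_neg_mul_sq (l := Real.pi * a) (by positivity)).congr fun n => ?_
      rw [Complex.norm_exp]
      congr 1
      simp [pow_two]
    have hr (n : ℤ) : Complex.exp (-Real.pi / a * (n + Complex.I * -(Complex.I * s)) ^ 2) =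
        (Real.exp (-l * ((n : ℝ) + s) ^ 2) : ℝ) := by
      rw [Complex.ofReal_exp]
      congr 1
      have : (-Real.pi / a : ℂ) = ((-l : ℝ) : ℂ) := by
        rw [ha, ← Complex.ofReal_neg, ← Complex.ofReal_div]
        congr 1
        field_simp
      rw [this]
      have : (Complex.I * -(Complex.I * s) : ℂ) = s := by
        rw [mul_neg, ← mul_assoc, Complex.I_mul_I]; ring
      rw [this]
      push_cast
      ring
    have h2 := Complex.hasSum_re hsum.hasSum
    simp only [hre] at h2
    rw [h] at h2
    simp only [hr] at h2
    rw [← Complex.ofReal_tsum] at h2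
    have hc : (1 / (a : ℂ) ^ (1 / 2 : ℂ)) = ((1 / a ^ (1 / 2 : ℝ) : ℝ) : ℂ) := by
      push_cast [Complex.ofReal_cpow ha0.le]
      rfl
    rwa [hc, ← Complex.ofReal_mul, Complex.ofReal_re] at h2
  have h0 := poisson 0
  simp only [add_zero] at h0
  have hlt := hasSum_lt (i := 1) (fun n => ?_) ?_ (poisson s) h0
  · exact lt_of_mul_lt_mul_left hlt (by positivity)
  · simp only [mul_zero, zero_mul, Real.cos_zero]
    exact mul_le_mul_of_nonneg_left (Real.cos_le_one _) (Real.exp_pos _).le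
  · simp only [mul_zero, zero_mul, Real.cos_zero]
    refine mul_lt_mul_of_pos_left ((Real.cos_le_one _).lt_of_ne fun hcos => hs ?_) (Real.exp_pos _)
    obtain ⟨n, hn⟩ := (Real.cos_eq_one_iff _).1 hcos
    refine ⟨n, ?_⟩
    have := Real.pi_pos
    push_cast at hn
    have : (n : ℝ) * (2 * Real.pi) = s * (2 * Real.pi) := by linarith
    exact mul_right_cancel₀ (by positivity) this

theorem tsum_exp_neg_mul_add_int_sq (l : ℝ) (k : ℤ) :
    ∑' j : ℤ, Real.exp (-l * ((j : ℝ) + k) ^ 2) = thetaSum l := by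
  rw [thetaSum, ← (Equiv.addRight k).tsum_eq fun j : ℤ => Real.exp (-l * (j : ℝ) ^ 2)]
  simp

theorem tsum_exp_neg_mul_add_sq_le {l : ℝ} (hl : 0 < l) (s : ℝ) :
    ∑' j : ℤ, Real.exp (-l * ((j : ℝ) + s) ^ 2) ≤ thetaSum l := by
  by_cases hs : s ∈ Set.range ((↑) : ℤ → ℝ)
  · obtain ⟨k, rfl⟩ := hs
    exact (tsum_exp_neg_mul_add_int_sq l k).le
  · exact (tsum_exp_neg_mul_add_sq_lt hl hs).le

theorem exp_neg_mul_sq_le_of_same_side {l x y : ℝ} (hl : 0 < l)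
    (h : (0 ≤ x ∧ x ≤ y) ∨ (x ≤ 0 ∧ y ≤ x)) : Real.exp (-l * y ^ 2) ≤ Real.exp (-l * x ^ 2) := by
  have : x ^ 2 ≤ y ^ 2 := by rcases h with h | h <;> nlinarith
  exact Real.exp_le_exp.2 (by nlinarith)

theorem eq_of_exp_neg_mul_sq_eq_of_same_side {l x y : ℝ} (hl : 0 < l)
    (h : (0 ≤ x ∧ x ≤ y) ∨ (x ≤ 0 ∧ y ≤ x))
    (e : Real.exp (-l * y ^ 2) = Real.exp (-l * x ^ 2)) : y = x := by
  have h1 : y ^ 2 = x ^ 2 := mul_left_cancel₀ (neg_ne_zero.2 hl.ne') (Real.exp_injective e)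
  rcases sq_eq_sq_iff_eq_or_eq_neg.1 h1 with h1 | h1
  · exact h1
  · rcases h with h | h <;> linarith

/-- A `1`-separated family is matched injectively with a translate of the integers whose points
lie on the same side of the origin and at least as close to it. -/
theorem exists_injective_lattice_of_separated {ι : Type*} (u : ι → ℝ)
    (hu : ∀ i j, i ≠ j → 1 ≤ |u i - u j|) :
    ∃ (a : ℝ) (φ : ι → ℤ), Function.Injective φ ∧
      ∀ i, (0 ≤ φ i + a ∧ φ i + a ≤ u i) ∨ (φ i + a ≤ 0 ∧ u i ≤ φ i + a) := by
  classical
  -- The offset `a` is the infimum of the nonnegative points; the extra `1` keeps the set nonempty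
  -- and `a ≤ 1`. By separation negative points lie at or below `a - 1`, so rounding down on the
  -- right and up on the left never crosses the origin. The two sides get indices `≥ 0` and `≤ -1`,
  -- and points of one side with the same index would be less than `1` apart.
  set T : Set ℝ := insert 1 {x | 0 ≤ x ∧ x ∈ Set.range u} with hT
  have hTb : ∀ x ∈ T, 0 ≤ x := by
    rintro x (rfl | hx)
    · norm_num
    · exact hx.1
  have hbdd : BddBelow T := ⟨0, hTb⟩
  have hne : T.Nonempty := ⟨1, Set.mem_insert _ _⟩
  set a := sInf T with ha
  have ha0 : 0 ≤ a := le_csInf hne hTb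
  have ha1 : a ≤ 1 := csInf_le hbdd (Set.mem_insert _ _)
  have hpos (i : ι) (hi : 0 ≤ u i) : a ≤ u i := csInf_le hbdd (Or.inr ⟨hi, i, rfl⟩)
  have hneg (i : ι) (hi : u i < 0) : u i + 1 ≤ a := by
    refine le_csInf hne ?_
    rintro x (rfl | ⟨hx, j, rfl⟩)
    · linarith
    · have hij : j ≠ i := by rintro rfl; linarith
      have := hu j i hij
      rw [abs_of_nonneg (by linarith)] at this
      linarith
  refine ⟨a, fun i => if 0 ≤ u i then ⌊u i - a⌋ else ⌈u i - a⌉, ?_, ?_⟩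
  · intro i j hij
    by_contra hne
    have hsep := hu i j hne
    have hp (i : ι) (hi : 0 ≤ u i) : 0 ≤ ⌊u i - a⌋ :=
      Int.floor_nonneg.2 (sub_nonneg.2 (hpos i hi))
    have hn (i : ι) (hi : ¬ 0 ≤ u i) : ⌈u i - a⌉ ≤ -1 := by
      have := hneg i (not_le.1 hi)
      rw [Int.ceil_le]
      push_cast
      linarith
    dsimp only at hij
    split_ifs at hij with h1 h2 h2
    · have := Int.abs_sub_lt_one_of_floor_eq_floor hij
      rw [sub_sub_sub_cancel_right] at this
      linarith
    · have := hp i h1; have := hn j h2; omega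
    · have := hn i h1; have := hp j h2; omega
    · have e1 := Int.ceil_lt_add_one (u i - a)
      have e2 := Int.le_ceil (u i - a)
      have e3 := Int.ceil_lt_add_one (u j - a)
      have e4 := Int.le_ceil (u j - a)
      rw [hij] at e1 e2
      have : |u i - u j| < 1 := abs_lt.2 ⟨by linarith, by linarith⟩
      linarith
  · intro i
    dsimp only
    split_ifs with h
    · left
      have h1 : (0 : ℝ) ≤ ⌊u i - a⌋ := by
        exact_mod_cast Int.floor_nonneg.2 (sub_nonneg.2 (hpos i h))
      have := Int.floor_le (u i - a)
      constructor <;> linarith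
    · right
      have h1 := hneg i (not_le.1 h)
      have h2 : (⌈u i - a⌉ : ℝ) ≤ -1 := by
        have : ⌈u i - a⌉ ≤ -1 := by
          rw [Int.ceil_le]; push_cast; linarith
        exact_mod_cast this
      have := Int.le_ceil (u i - a)
      constructor <;> linarith

section Separated

variable {ι : Type*} {u : ι → ℝ} {l : ℝ}

theorem summable_exp_neg_mul_sq_of_separated (hl : 0 < l)
    (hu : ∀ i j, i ≠ j → 1 ≤ |u i - u j|) : Summable fun i => Real.exp (-l * u i ^ 2) := by
  obtain ⟨a, φ, hφ, h⟩ := exists_injective_lattice_of_separated u hu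
  refine Summable.of_nonneg_of_le (fun i => (Real.exp_pos _).le) (fun i => ?_)
    ((summable_exp_neg_mul_add_sq hl a).comp_injective hφ)
  exact exp_neg_mul_sq_le_of_same_side hl (h i)

/-- Among `1`-separated families the integers have the largest Gaussian sum. -/
theorem tsum_exp_neg_mul_sq_le_of_separated (hl : 0 < l)
    (hu : ∀ i j, i ≠ j → 1 ≤ |u i - u j|) : ∑' i, Real.exp (-l * u i ^ 2) ≤ thetaSum l := by
  obtain ⟨a, φ, hφ, h⟩ := exists_injective_lattice_of_separated u hu
  refine le_trans ?_ (tsum_exp_neg_mul_add_sq_le hl a)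
  refine Summable.tsum_le_tsum_of_inj φ hφ (fun _ _ => (Real.exp_pos _).le) (fun i => ?_)
    (summable_exp_neg_mul_sq_of_separated hl hu) (summable_exp_neg_mul_add_sq hl a)
  exact exp_neg_mul_sq_le_of_same_side hl (h i)

/-- Only the integers themselves attain the largest Gaussian sum of a `1`-separated family. -/
theorem range_eq_int_of_tsum_eq_thetaSum (hl : 0 < l)
    (hu : ∀ i j, i ≠ j → 1 ≤ |u i - u j|) (heq : ∑' i, Real.exp (-l * u i ^ 2) = thetaSum l) :
    Set.range u = Set.range ((↑) : ℤ → ℝ) := by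
  obtain ⟨a, φ, hφ, h⟩ := exists_injective_lattice_of_separated u hu
  have hsA := summable_exp_neg_mul_sq_of_separated hl hu
  have hsZ := summable_exp_neg_mul_add_sq hl a
  have hle (i : ι) : Real.exp (-l * u i ^ 2) ≤ Real.exp (-l * ((φ i : ℝ) + a) ^ 2) :=
    exp_neg_mul_sq_le_of_same_side hl (h i)
  have h1 : ∑' i, Real.exp (-l * u i ^ 2) ≤ ∑' i, Real.exp (-l * ((φ i : ℝ) + a) ^ 2) :=
    hsA.tsum_le_tsum hle (hsZ.comp_injective hφ)
  have h2 : ∑' i, Real.exp (-l * ((φ i : ℝ) + a) ^ 2) ≤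
      ∑' j : ℤ, Real.exp (-l * ((j : ℝ) + a) ^ 2) :=
    tsum_comp_le_tsum_of_inj hsZ (fun _ => (Real.exp_pos _).le) hφ
  -- Equality makes every step of the comparison tight: the translate is by an integer, no point was
  -- moved (`hval`), and no lattice point was missed (`hsurj`).
  have ha : a ∈ Set.range ((↑) : ℤ → ℝ) := by
    by_contra ha
    have := tsum_exp_neg_mul_add_sq_lt hl ha
    linarith
  obtain ⟨k, rfl⟩ := ha
  rw [tsum_exp_neg_mul_add_int_sq] at h2
  have hval (i : ι) : u i = φ i + k := by
    by_contra hne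
    have hlt : Real.exp (-l * u i ^ 2) < Real.exp (-l * ((φ i : ℝ) + k) ^ 2) :=
      (hle i).lt_of_ne fun e => hne (eq_of_exp_neg_mul_sq_eq_of_same_side hl (h i) e)
    have := Summable.tsum_lt_tsum hle hlt hsA (hsZ.comp_injective hφ)
    linarith
  have hsurj : Function.Surjective φ := by
    intro n
    by_contra hn
    have h3 := tsum_range (fun j : ℤ => Real.exp (-l * ((j : ℝ) + k) ^ 2)) hφ
    rw [tsum_subtype (Set.range φ) fun j : ℤ => Real.exp (-l * ((j : ℝ) + k) ^ 2)] at h3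
    have h4 := Summable.tsum_lt_tsum (i := n)
      (Set.indicator_le_self' (s := Set.range φ) fun j _ => (Real.exp_pos _).le)
      (by rw [Set.indicator_of_notMem (show n ∉ Set.range φ from hn)]; exact Real.exp_pos _) (hsZ.indicator _) hsZ
    rw [tsum_exp_neg_mul_add_int_sq] at h4
    linarith
  ext x
  constructor
  · rintro ⟨i, rfl⟩
    exact ⟨φ i + k, by rw [hval]; push_cast; rfl⟩
  · rintro ⟨n, rfl⟩
    obtain ⟨i, hi⟩ := hsurj (n - k)
    exact ⟨i, by rw [hval, hi]; push_cast; ring⟩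

end Separated

/-! ### Mass, entropy and second moment of the discrete Gaussian law -/

/-- A law carried by a countable set integrates as a sum over its atoms. -/
theorem lintegral_eq_tsum_of_countable {P : Measure ℝ} {s : Set ℝ} (hs : s.Countable)
    (hP : P sᶜ = 0) (g : ℝ → ℝ≥0∞) : ∫⁻ x, g x ∂P = ∑' x : ℝ, g x * P {x} := by
  have h1 : P.restrict s = P := Measure.restrict_eq_self_of_ae_mem (by
    rw [ae_iff]; exact hP)
  conv_lhs => rw [← h1]
  rw [lintegral_countable g hs]
  refine tsum_subtype_eq_of_support_subset (f := fun x => g x * P {x}) fun x hx => ?_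
  by_contra hxs
  refine hx ?_
  have : P {x} = 0 := measure_mono_null (Set.singleton_subset_iff.2 hxs) hP
  simp [this]

/-- The mass of the discrete Gaussian law at the `i`-th lattice point. -/
noncomputable def discreteGaussianMass (l : ℝ) (i : ℤ) : ℝ :=
  Real.exp (-logTheta l - l * (i : ℝ) ^ 2)

section DiscreteGaussian

variable {β l : ℝ}

theorem discreteGaussianMass_pos (l : ℝ) (i : ℤ) : 0 < discreteGaussianMass l i := Real.exp_pos _

theorem exp_neg_logTheta (hl : 0 < l) : Real.exp (-logTheta l) = (thetaSum l)⁻¹ := by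
  rw [Real.exp_neg]
  congr 1
  exact Real.exp_log (thetaSum_pos hl)

theorem discreteGaussianMass_eq (l : ℝ) (i : ℤ) :
    discreteGaussianMass l i = Real.exp (-logTheta l) * Real.exp (-l * (i : ℝ) ^ 2) := by
  rw [discreteGaussianMass, ← Real.exp_add]; congr 1; ring

theorem hasSum_discreteGaussianMass (hl : 0 < l) : HasSum (discreteGaussianMass l) 1 := by
  have := (summable_exp_neg_mul_sq hl).hasSum.mul_left (Real.exp (-logTheta l))
  simp only [← discreteGaussianMass_eq] at this
  change HasSum (discreteGaussianMass l) (_ * thetaSum l) at this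
  rwa [exp_neg_logTheta hl, inv_mul_cancel₀ (thetaSum_pos hl).ne'] at this

theorem hasSum_discreteGaussianMass_mul_sq (hl : 0 < l) :
    HasSum (fun i => discreteGaussianMass l i * (i : ℝ) ^ 2) (-deriv logTheta l) := by
  have := (summable_sq_mul_exp_neg_mul_sq hl).hasSum.mul_left (Real.exp (-logTheta l))
  have e : (fun i => discreteGaussianMass l i * (i : ℝ) ^ 2) = fun i : ℤ =>
      Real.exp (-logTheta l) * ((i : ℝ) ^ 2 * Real.exp (-l * (i : ℝ) ^ 2)) := by
    ext i
    rw [discreteGaussianMass_eq]; ring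
  rw [e, deriv_logTheta hl, neg_neg, div_eq_inv_mul, ← exp_neg_logTheta hl]
  exact this

theorem lintegral_discreteGaussian (β l : ℝ) (g : ℝ → ℝ≥0∞) :
    ∫⁻ x, g x ∂discreteGaussian β l =
      ∑' i : ℤ, ENNReal.ofReal (discreteGaussianMass l i) * g (β * i) := by
  rw [discreteGaussian, lintegral_sum_measure]
  simp [lintegral_smul_measure, lintegral_dirac, discreteGaussianMass]

theorem discreteGaussian_apply (β l : ℝ) {s : Set ℝ} (hs : MeasurableSet s) :
    discreteGaussian β l s =
      ∑' i : ℤ, ENNReal.ofReal (discreteGaussianMass l i) * s.indicator 1 (β * i) := by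
  rw [← lintegral_indicator_one hs, lintegral_discreteGaussian]

theorem isProbabilityMeasure_discreteGaussian (hl : 0 < l) :
    IsProbabilityMeasure (discreteGaussian β l) := by
  constructor
  rw [discreteGaussian_apply _ _ MeasurableSet.univ]
  simp only [Set.indicator_univ, Pi.one_apply, mul_one]
  rw [← ENNReal.ofReal_tsum_of_nonneg (fun i => (discreteGaussianMass_pos l i).le)
    (hasSum_discreteGaussianMass hl).summable, (hasSum_discreteGaussianMass hl).tsum_eq,
    ENNReal.ofReal_one]

theorem discreteGaussian_singleton (hβ : β ≠ 0) (l : ℝ) (i : ℤ) :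
    discreteGaussian β l {β * i} = ENNReal.ofReal (discreteGaussianMass l i) := by
  rw [discreteGaussian_apply _ _ (measurableSet_singleton _), tsum_eq_single i]
  · simp
  · intro j hj
    have : β * (j : ℝ) ≠ β * i := fun e => hj (by exact_mod_cast mul_left_cancel₀ hβ e)
    simp [this]

theorem discreteGaussian_compl_range (β l : ℝ) :
    discreteGaussian β l (Set.range fun i : ℤ => β * (i : ℝ))ᶜ = 0 := by
  rw [discreteGaussian_apply _ _ (Set.countable_range _).measurableSet.compl]
  simp

theorem discreteGaussian_singleton_of_notMem {x : ℝ}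
    (hx : x ∉ Set.range fun i : ℤ => β * (i : ℝ)) : discreteGaussian β l {x} = 0 :=
  measure_mono_null (Set.singleton_subset_iff.2 hx) (discreteGaussian_compl_range β l)

theorem injective_mul_intCast (hβ : β ≠ 0) : Function.Injective fun i : ℤ => β * (i : ℝ) :=
  fun _ _ e => by exact_mod_cast mul_left_cancel₀ hβ e

/-- Since `-log` of the mass is affine in `i²`, the entropy depends only on the total mass and the
second moment. -/
theorem negMulLog_discreteGaussianMass (l : ℝ) (i : ℤ) :
    Real.negMulLog (discreteGaussianMass l i) =
      discreteGaussianMass l i * logTheta l + l * (discreteGaussianMass l i * (i : ℝ) ^ 2) := by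
  rw [Real.negMulLog, discreteGaussianMass, Real.log_exp]; ring

theorem entropy_discreteGaussian (hβ : β ≠ 0) (hl : 0 < l) :
    entropy (discreteGaussian β l) = ENNReal.ofReal (logTheta l - l * deriv logTheta l) := by
  rw [entropy, if_pos ⟨_, Set.countable_range _, discreteGaussian_compl_range β l⟩]
  have hsupp : Function.support
      (fun x : ℝ => ENNReal.ofReal (Real.negMulLog ((discreteGaussian β l).real {x}))) ⊆
      Set.range fun i : ℤ => β * (i : ℝ) := by
    intro x hx
    by_contra h
    exact hx (by simp [Measure.real, discreteGaussian_singleton_of_notMem h])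
  rw [← (injective_mul_intCast hβ).tsum_eq hsupp]
  simp only [Measure.real, discreteGaussian_singleton hβ,
    ENNReal.toReal_ofReal (discreteGaussianMass_pos _ _).le, negMulLog_discreteGaussianMass]
  have hs := ((hasSum_discreteGaussianMass hl).mul_right (logTheta l)).add
    ((hasSum_discreteGaussianMass_mul_sq hl).mul_left l)
  have h0 := logTheta_nonneg hl
  rw [← ENNReal.ofReal_tsum_of_nonneg (fun i => by
    have := discreteGaussianMass_pos l i
    positivity) hs.summable, hs.tsum_eq]
  congr 1
  ring

theorem secondMoment_discreteGaussian (hl : 0 < l) (hβ : β ^ 2 * -deriv logTheta l = 1) :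
    secondMoment (discreteGaussian β l) = 1 := by
  rw [secondMoment, lintegral_discreteGaussian]
  have hs := (hasSum_discreteGaussianMass_mul_sq hl).mul_left (β ^ 2)
  rw [hβ] at hs
  rw [← ENNReal.ofReal_one, ← hs.tsum_eq, ENNReal.ofReal_tsum_of_nonneg _ hs.summable]
  · refine tsum_congr fun i => ?_
    rw [← ENNReal.ofReal_mul (discreteGaussianMass_pos _ _).le]
    congr 1
    ring
  · intro i
    have := discreteGaussianMass_pos l i
    positivity

end DiscreteGaussian

/-! ### Entropy maximization for separated atoms -/

/-- Two laws carried by countable sets agree if their atoms do. -/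
theorem measure_eq_of_singleton_eq {P Q : Measure ℝ} {s t : Set ℝ} (hs : s.Countable)
    (hP : P sᶜ = 0) (ht : t.Countable) (hQ : Q tᶜ = 0) (h : ∀ x, P {x} = Q {x}) : P = Q := by
  ext A hA
  rw [← lintegral_indicator_one hA, ← lintegral_indicator_one hA,
    lintegral_eq_tsum_of_countable hs hP, lintegral_eq_tsum_of_countable ht hQ]
  simp [h]

/-- Gibbs' inequality for one term, from `exp t ≥ 1 + t` at `t = -c - log p`. Keeping `p` on the
left makes both sides nonnegative when `p ≤ 1` and `c ≥ 0`, so that they can be summed in `ℝ≥0∞`. -/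
theorem negMulLog_add_le {p c : ℝ} (hp : 0 < p) :
    Real.negMulLog p + p ≤ p * c + Real.exp (-c) ∧
      (Real.negMulLog p + p = p * c + Real.exp (-c) → p = Real.exp (-c)) := by
  have e : Real.exp (-c) = p * Real.exp (-c - Real.log p) := by
    rw [Real.exp_sub, Real.exp_log hp]; field_simp
  rw [Real.negMulLog]
  constructor
  · rw [e]
    nlinarith [mul_le_mul_of_nonneg_left (Real.add_one_le_exp (-c - Real.log p)) hp.le]
  · intro h
    by_contra hne
    have hne' : -c - Real.log p ≠ 0 := fun h0 => hne (by rw [e, h0]; simp)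
    have := mul_lt_mul_of_pos_left (Real.add_one_lt_exp hne') hp
    rw [← e] at this
    nlinarith

/-- Among the laws with `E[X²] ≤ 1` whose atoms are `d`-separated, only the discrete Gaussian law
has entropy as large as its own. -/
theorem eq_discreteGaussian_of_separated {P : Measure ℝ} [IsProbabilityMeasure P] {l d h : ℝ}
    (hl : 0 < l) (hd : 0 < d) (hd2 : d ^ 2 * -deriv logTheta l = 1)
    (hh : h = logTheta l - l * deriv logTheta l) (hent : entropy P = ENNReal.ofReal h)
    (hmom : secondMoment P ≤ 1)
    (hsep : ∀ x y : ℝ, P {x} ≠ 0 → P {y} ≠ 0 → x ≠ y → d ≤ |x - y|) :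
    P = discreteGaussian d l := by
  have hcount : ∃ s : Set ℝ, s.Countable ∧ P sᶜ = 0 := by
    by_contra hc
    rw [entropy, if_neg hc] at hent
    exact ENNReal.ofReal_ne_top hent.symm
  rw [entropy, if_pos hcount] at hent
  obtain ⟨s, hs, hP⟩ := hcount
  have hL := logTheta_nonneg hl
  have hh0 : 0 ≤ h := by
    rw [hh]; nlinarith [deriv_logTheta_neg hl]
  let ι := {x : ℝ // P {x} ≠ 0}
  let u : ι → ℝ := fun x => x.1 / d
  have hu : ∀ i j, i ≠ j → 1 ≤ |u i - u j| := by
    intro i j hij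
    have := hsep i.1 j.1 i.2 j.2 (fun e => hij (Subtype.ext e))
    rw [← sub_div, abs_div, abs_of_pos hd, le_div_iff₀ hd, one_mul]
    exact this
  -- Minus the logarithm of the discrete Gaussian weight, extended from lattice points to the
  -- rescaled atoms of `P`.
  let c : ι → ℝ := fun i => logTheta l + l * u i ^ 2
  have hc0 (i : ι) : 0 ≤ c i := by positivity
  have hp (i : ι) : 0 < P.real {i.1} := ENNReal.toReal_pos i.2 (measure_ne_top _ _)
  have hp1 (i : ι) : P.real {i.1} ≤ 1 := measureReal_le_one
  have hpe (i : ι) : ENNReal.ofReal (P.real {i.1}) = P {i.1} :=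
    ENNReal.ofReal_toReal (measure_ne_top _ _)
  have restrict_tsum (g : ℝ → ℝ≥0∞) (hg : ∀ x, P {x} = 0 → g x = 0) :
      ∑' x : ℝ, g x = ∑' i : ι, g i.1 :=
    (tsum_subtype_eq_of_support_subset (s := {x | P {x} ≠ 0}) (f := g)
      fun x hx h0 => hx (hg x h0)).symm
  have hq : Summable fun i => Real.exp (-c i) := by
    refine ((summable_exp_neg_mul_sq_of_separated hl hu).mul_left (Real.exp (-logTheta l))).congr
      fun i => ?_
    rw [← Real.exp_add]; congr 1; simp only [c]; ring
  have hqs : ∑' i, Real.exp (-c i) = (thetaSum l)⁻¹ * ∑' i, Real.exp (-l * u i ^ 2) := by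
    rw [← exp_neg_logTheta hl, ← tsum_mul_left]
    refine tsum_congr fun i => ?_
    rw [← Real.exp_add]; congr 1; simp only [c]; ring
  have hT := thetaSum_pos hl
  have hq1 : ∑' i, Real.exp (-c i) ≤ 1 := by
    rw [hqs, inv_mul_le_iff₀ hT, mul_one]
    exact tsum_exp_neg_mul_sq_le_of_separated hl hu
  have hmass : ∑' i : ι, P {i.1} = 1 := by
    rw [← restrict_tsum _ fun _ h => h, ← measure_univ (μ := P), ← lintegral_one,
      lintegral_eq_tsum_of_countable hs hP]
    simp
  have hmom' : ∑' i : ι, ENNReal.ofReal (i.1 ^ 2) * P {i.1} ≤ 1 := by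
    rw [← restrict_tsum (fun x => ENNReal.ofReal (x ^ 2) * P {x}) fun x h => by simp [h],
      ← lintegral_eq_tsum_of_countable hs hP]
    exact hmom
  have hent' : ∑' i : ι, ENNReal.ofReal (Real.negMulLog (P.real {i.1})) = ENNReal.ofReal h := by
    rw [← hent, restrict_tsum]
    intro x hx
    simp [Measure.real, hx]
  have hleft : ∑' i : ι, ENNReal.ofReal (Real.negMulLog (P.real {i.1}) + P.real {i.1}) =
      ENNReal.ofReal h + 1 := by
    rw [← hent', ← hmass, ← ENNReal.tsum_add]
    refine tsum_congr fun i => ?_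
    rw [ENNReal.ofReal_add (Real.negMulLog_nonneg (hp i).le (hp1 i)) (hp i).le, hpe]
  -- The mean of `c` is `L + (l / d²) E[X²]`, which is at most `L - l L' = h` by `hd2` and the
  -- moment bound.
  have hright : ∑' i : ι, ENNReal.ofReal (P.real {i.1} * c i + Real.exp (-c i)) ≤
      ENNReal.ofReal h + ENNReal.ofReal (∑' i, Real.exp (-c i)) := by
    have e (i : ι) : ENNReal.ofReal (P.real {i.1} * c i + Real.exp (-c i)) =
        ENNReal.ofReal (logTheta l) * P {i.1} +
        ENNReal.ofReal (l / d ^ 2) * (ENNReal.ofReal (i.1 ^ 2) * P {i.1}) +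
        ENNReal.ofReal (Real.exp (-c i)) := by
      rw [← hpe, ← ENNReal.ofReal_mul hL, ← ENNReal.ofReal_mul (sq_nonneg _),
        ← ENNReal.ofReal_mul (by positivity), ← ENNReal.ofReal_add (mul_nonneg hL (hp i).le)
          (mul_nonneg (by positivity) (mul_nonneg (sq_nonneg _) (hp i).le)),
        ← ENNReal.ofReal_add (add_nonneg (mul_nonneg hL (hp i).le)
          (mul_nonneg (by positivity) (mul_nonneg (sq_nonneg _) (hp i).le))) (Real.exp_pos _).le]
      congr 1
      simp only [c, u]
      field_simp
    simp only [e]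
    rw [ENNReal.tsum_add, ENNReal.tsum_add, ENNReal.tsum_mul_left, ENNReal.tsum_mul_left, hmass,
      mul_one, ENNReal.ofReal_tsum_of_nonneg (fun i => (Real.exp_pos _).le) hq]
    gcongr
    refine (add_le_add_right (mul_le_of_le_one_right' hmom') _).trans ?_
    rw [← ENNReal.ofReal_add hL (by positivity)]
    refine ENNReal.ofReal_le_ofReal ?_
    rw [hh]
    have : l / d ^ 2 = l * -deriv logTheta l := by
      rw [div_eq_iff (by positivity)]; linear_combination (-l) * hd2
    linarith
  have hterm (i : ι) : ENNReal.ofReal (Real.negMulLog (P.real {i.1}) + P.real {i.1}) ≤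
      ENNReal.ofReal (P.real {i.1} * c i + Real.exp (-c i)) :=
    ENNReal.ofReal_le_ofReal (negMulLog_add_le (hp i)).1
  -- Summing Gibbs' inequality gives `h + 1 ≤ h + ∑ exp (-c)`. Hence the weights sum to exactly `1`,
  -- and each term must be an equality, for a strict one would give `h + 1 < h + 1`.
  have hsum_one : ∑' i, Real.exp (-c i) = 1 := by
    refine le_antisymm hq1 ?_
    have h1 := (hleft.symm.le.trans (ENNReal.tsum_le_tsum hterm)).trans hright
    rw [ENNReal.add_le_add_iff_left ENNReal.ofReal_ne_top] at h1
    exact ENNReal.one_le_ofReal.1 h1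
  have hval (i : ι) : P.real {i.1} = Real.exp (-c i) := by
    refine (negMulLog_add_le (hp i)).2 ?_
    by_contra hne
    have hlt := lt_of_le_of_ne (negMulLog_add_le (c := c i) (hp i)).1 hne
    have hpos : 0 < P.real {i.1} * c i + Real.exp (-c i) := by
      have := hp i; have := hc0 i; positivity
    have := ENNReal.tsum_lt_tsum (hleft.trans_ne (by finiteness)) hterm
      ((ENNReal.ofReal_lt_ofReal_iff hpos).2 hlt)
    rw [hleft] at this
    have h1 := this.trans_le hright
    rw [hsum_one, ENNReal.ofReal_one] at h1
    exact lt_irrefl _ h1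
  have hrange : Set.range u = Set.range ((↑) : ℤ → ℝ) := by
    refine range_eq_int_of_tsum_eq_thetaSum hl hu ?_
    rw [hqs, inv_mul_eq_iff_eq_mul₀ hT.ne', mul_one] at hsum_one
    exact hsum_one
  refine measure_eq_of_singleton_eq hs hP (Set.countable_range _)
    (discreteGaussian_compl_range d l) fun x => ?_
  by_cases hx : P {x} = 0
  · rw [hx, discreteGaussian_singleton_of_notMem]
    rintro ⟨k, rfl⟩
    obtain ⟨i, hi⟩ := hrange.symm ▸ Set.mem_range_self (f := ((↑) : ℤ → ℝ)) k
    have : i.1 = d * k := by rw [← hi]; simp only [u]; field_simp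
    exact i.2 (this ▸ hx)
  · obtain ⟨k, hk⟩ := hrange ▸ Set.mem_range_self (f := u) ⟨x, hx⟩
    have hxk : x = d * k := by rw [hk]; simp only [u]; field_simp
    have h1 := hval ⟨x, hx⟩
    have h2 : discreteGaussian d l {x} = ENNReal.ofReal (discreteGaussianMass l k) := by
      rw [hxk, discreteGaussian_singleton hd.ne']
    rw [← hpe ⟨x, hx⟩, h1, h2, discreteGaussianMass]
    congr 2
    simp only [c, ← hk]
    ring

/-! ### Output density and the decomposition of the entropy -/

/-- The density of `X + Z` for `X ∼ P` and an independent `Z ∼ N(0, v)`. -/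
noncomputable def outputPDF (P : Measure ℝ) (v : ℝ≥0) (y : ℝ) : ℝ≥0∞ :=
  ∫⁻ x, gaussianPDF 0 v (y - x) ∂P

/-- The logarithm of `1 / P(X = x | Y = y)` for the channel with noise `N(0, v)`. -/
noncomputable def posteriorSurprise (P : Measure ℝ) (v : ℝ≥0) (x y : ℝ) : ℝ :=
  -Real.log (P.real {x}) - Real.log (gaussianPDFReal 0 v (y - x) / (outputPDF P v y).toReal)

/-- The conditional entropy `H(X | X + Z)` for `X ∼ P` and an independent `Z ∼ N(0, v)`. -/
noncomputable def equivocation (P : Measure ℝ) (v : ℝ≥0) : ℝ≥0∞ :=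
  ∫⁻ x, (∫⁻ y, ENNReal.ofReal (gaussianPDFReal 0 v (y - x) * posteriorSurprise P v x y)) ∂P

section OutputPDF

variable {P : Measure ℝ} {v : ℝ≥0}

theorem measurable_gaussianPDF_sub (v : ℝ≥0) :
    Measurable fun z : ℝ × ℝ => gaussianPDF 0 v (z.2 - z.1) :=
  (measurable_gaussianPDF 0 v).comp (measurable_snd.sub measurable_fst)

theorem measurable_gaussianPDF_const_sub (v : ℝ≥0) (y : ℝ) :
    Measurable fun x : ℝ => gaussianPDF 0 v (y - x) :=
  (measurable_gaussianPDF 0 v).comp (measurable_const.sub measurable_id)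

theorem measurable_outputPDF (P : Measure ℝ) [SFinite P] (v : ℝ≥0) :
    Measurable (outputPDF P v) :=
  Measurable.lintegral_prod_left' (measurable_gaussianPDF_sub v)

theorem gaussianPDFReal_zero_le (v : ℝ≥0) (z : ℝ) :
    gaussianPDFReal 0 v z ≤ (√(2 * Real.pi * v))⁻¹ := by
  rw [gaussianPDFReal]
  refine mul_le_of_le_one_right (by positivity) (Real.exp_le_one_iff.2 ?_)
  rw [neg_div, neg_nonpos]
  positivity

theorem outputPDF_ne_top [IsProbabilityMeasure P] (v : ℝ≥0) (y : ℝ) : outputPDF P v y ≠ ∞ := by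
  have : outputPDF P v y ≤ ∫⁻ _, ENNReal.ofReal (√(2 * Real.pi * v))⁻¹ ∂P :=
    lintegral_mono fun x => ENNReal.ofReal_le_ofReal (gaussianPDFReal_zero_le v _)
  refine ne_top_of_le_ne_top ?_ this
  rw [lintegral_const, measure_univ, mul_one]
  exact ENNReal.ofReal_ne_top

theorem outputPDF_ne_zero [IsProbabilityMeasure P] (hv : v ≠ 0) (y : ℝ) :
    outputPDF P v y ≠ 0 := by
  intro h
  rw [outputPDF, lintegral_eq_zero_iff (measurable_gaussianPDF_const_sub v y)] at h
  obtain ⟨x, hx⟩ := h.exists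
  exact (gaussianPDF_pos 0 hv (y - x)).ne' hx

theorem outputPDF_toReal_pos [IsProbabilityMeasure P] (hv : v ≠ 0) (y : ℝ) :
    0 < (outputPDF P v y).toReal :=
  ENNReal.toReal_pos (outputPDF_ne_zero hv y) (outputPDF_ne_top v y)

theorem sum_le_outputPDF [IsProbabilityMeasure P] (v : ℝ≥0) (y : ℝ) (s : Finset ℝ) :
    ∑ x ∈ s, P.real {x} * gaussianPDFReal 0 v (y - x) ≤ (outputPDF P v y).toReal := by
  have h : ∑ x ∈ s, gaussianPDF 0 v (y - x) * P {x} ≤ outputPDF P v y := by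
    rw [← lintegral_finset]
    exact setLIntegral_le_lintegral _ _
  refine le_trans (le_of_eq ?_) (ENNReal.toReal_mono (outputPDF_ne_top v y) h)
  have hfin (x : ℝ) : gaussianPDF 0 v (y - x) * P {x} ≠ ∞ :=
    ENNReal.mul_ne_top ENNReal.ofReal_ne_top (measure_ne_top _ _)
  rw [ENNReal.toReal_sum fun x _ => hfin x]
  refine Finset.sum_congr rfl fun x _ => ?_
  rw [ENNReal.toReal_mul, gaussianPDF, ENNReal.toReal_ofReal (gaussianPDFReal_nonneg _ _ _),
    mul_comm]
  rfl

theorem posteriorSurprise_eq_log [IsProbabilityMeasure P] (hv : v ≠ 0) {x : ℝ} (y : ℝ)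
    (hx : P {x} ≠ 0) : posteriorSurprise P v x y =
      Real.log ((outputPDF P v y).toReal / (P.real {x} * gaussianPDFReal 0 v (y - x))) := by
  have h1 := outputPDF_toReal_pos (P := P) hv y
  have h2 := gaussianPDFReal_pos 0 v (y - x) hv
  have h3 : 0 < P.real {x} := ENNReal.toReal_pos hx (measure_ne_top _ _)
  rw [posteriorSurprise, Real.log_div h2.ne' h1.ne', Real.log_div h1.ne' (by positivity),
    Real.log_mul h3.ne' h2.ne']
  ring

theorem posteriorSurprise_nonneg [IsProbabilityMeasure P] (hv : v ≠ 0) {x : ℝ} (y : ℝ)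
    (hx : P {x} ≠ 0) : 0 ≤ posteriorSurprise P v x y := by
  have h2 := gaussianPDFReal_pos 0 v (y - x) hv
  have h3 : 0 < P.real {x} := ENNReal.toReal_pos hx (measure_ne_top _ _)
  rw [posteriorSurprise_eq_log hv y hx]
  refine Real.log_nonneg ((one_le_div (by positivity)).2 ?_)
  simpa using sum_le_outputPDF (P := P) v y {x}

/-- The mass of `{x}` is the mass of the slice at `x` of the diagonal, which is measurable in the
product. -/
theorem measurable_real_singleton (P : Measure ℝ) [SFinite P] :
    Measurable fun x => P.real {x} := by
  have := measurable_measure_prodMk_left (ν := P) (measurableSet_diagonal (α := ℝ))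
  refine Measurable.ennreal_toReal (f := fun x => P {x}) ?_
  convert this using 3 with x
  ext y
  simp [eq_comm]

theorem measurable_posteriorSurprise (P : Measure ℝ) [SFinite P] (v : ℝ≥0) :
    Measurable fun z : ℝ × ℝ => posteriorSurprise P v z.1 z.2 := by
  have h1 : Measurable fun z : ℝ × ℝ => P.real {z.1} :=
    (measurable_real_singleton P).comp measurable_fst
  have h2 : Measurable fun z : ℝ × ℝ => (outputPDF P v z.2).toReal :=
    ((measurable_outputPDF P v).comp measurable_snd).ennreal_toReal
  have h3 : Measurable fun z : ℝ × ℝ => gaussianPDFReal 0 v (z.2 - z.1) :=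
    (measurable_gaussianPDFReal 0 v).comp (measurable_snd.sub measurable_fst)
  exact h1.log.neg.sub (h3.div h2).log

theorem map_input_output (P : Measure ℝ) [IsProbabilityMeasure P] (hv : v ≠ 0) :
    (P.prod (gaussianReal 0 v)).map (fun ω : ℝ × ℝ => (ω.1, ω.1 + ω.2)) =
      (P.prod volume).withDensity fun z => gaussianPDF 0 v (z.2 - z.1) := by
  refine Measure.ext_of_lintegral _ fun φ hφ => ?_
  have hm : Measurable fun ω : ℝ × ℝ => (ω.1, ω.1 + ω.2) := by fun_prop
  rw [lintegral_map hφ hm, lintegral_prod (fun ω : ℝ × ℝ => φ (ω.1, ω.1 + ω.2)) (hφ.comp hm).aemeasurable,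
    lintegral_withDensity_eq_lintegral_mul _ (measurable_gaussianPDF_sub v) hφ,
    lintegral_prod _ ((measurable_gaussianPDF_sub v).mul hφ).aemeasurable]
  refine lintegral_congr fun x => ?_
  rw [gaussianReal_of_var_ne_zero _ hv, lintegral_withDensity_eq_lintegral_mul _
    (measurable_gaussianPDF 0 v) (by fun_prop)]
  rw [← lintegral_sub_right_eq_self _ x]
  refine lintegral_congr fun y => ?_
  simp

theorem map_output (P : Measure ℝ) [IsProbabilityMeasure P] (hv : v ≠ 0) :
    (P.prod (gaussianReal 0 v)).map (fun ω : ℝ × ℝ => ω.1 + ω.2) =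
      volume.withDensity (outputPDF P v) := by
  have hm : Measurable fun ω : ℝ × ℝ => (ω.1, ω.1 + ω.2) := by fun_prop
  have h : (P.prod (gaussianReal 0 v)).map (fun ω : ℝ × ℝ => ω.1 + ω.2) =
      ((P.prod (gaussianReal 0 v)).map (fun ω : ℝ × ℝ => (ω.1, ω.1 + ω.2))).map Prod.snd := by
    rw [Measure.map_map measurable_snd hm]; rfl
  rw [h, map_input_output P hv]
  refine Measure.ext_of_lintegral _ fun φ hφ => ?_
  have hφ2 : Measurable fun z : ℝ × ℝ => φ z.2 := hφ.comp measurable_snd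
  rw [lintegral_map hφ measurable_snd,
    lintegral_withDensity_eq_lintegral_mul _ (measurable_gaussianPDF_sub v) hφ2,
    lintegral_prod_symm _ ((measurable_gaussianPDF_sub v).mul hφ2).aemeasurable,
    lintegral_withDensity_eq_lintegral_mul _ (measurable_outputPDF P v) hφ]
  refine lintegral_congr fun y => ?_
  simp only [Pi.mul_apply]
  rw [lintegral_mul_const _ (measurable_gaussianPDF_const_sub v y)]
  rfl

/-- The information transmitted by the channel and the equivocation add up to the entropy. -/
theorem gaussianChannelInfo_add_equivocation {P : Measure ℝ} [IsProbabilityMeasure P] {s : Set ℝ}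
    (hs : s.Countable) (hP : P sᶜ = 0) {snr : ℝ} (hsnr : 0 < snr) :
    gaussianChannelInfo snr P + equivocation P (1 / snr).toNNReal = entropy P := by
  have hv : (1 / snr).toNNReal ≠ 0 := (Real.toNNReal_pos.2 (by positivity)).ne'
  rw [gaussianChannelInfo, mutualInfo]
  set v := (1 / snr).toNNReal
  have hfst : (P.prod (gaussianReal 0 v)).map (fun ω : ℝ × ℝ => ω.1) = P := by
    simp
  have hm : Measurable fun ω : ℝ × ℝ => (ω.1, ω.1 + ω.2) := by fun_prop
  set J := (P.prod (gaussianReal 0 v)).map (fun ω : ℝ × ℝ => (ω.1, ω.1 + ω.2)) with hJ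
  have hJprob : IsProbabilityMeasure J := Measure.isProbabilityMeasure_map hm.aemeasurable
  have hYprob : IsProbabilityMeasure ((P.prod (gaussianReal 0 v)).map fun ω : ℝ × ℝ => ω.1 + ω.2) :=
    Measure.isProbabilityMeasure_map (by fun_prop)
  rw [hfst]
  set N := P.prod ((P.prod (gaussianReal 0 v)).map fun ω : ℝ × ℝ => ω.1 + ω.2) with hN
  -- The density of the joint law with respect to the product of its marginals: conditional over
  -- marginal output density.
  let t : ℝ × ℝ → ℝ≥0∞ := fun z => gaussianPDF 0 v (z.2 - z.1) / outputPDF P v z.2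
  have htm : Measurable t :=
    (measurable_gaussianPDF_sub v).div ((measurable_outputPDF P v).comp measurable_snd)
  have hJN : J = N.withDensity t := by
    rw [hJ, hN, map_input_output P hv, map_output P hv,
      prod_withDensity_right (measurable_outputPDF P v),
      ← withDensity_mul _ (f := fun z : ℝ × ℝ => outputPDF P v z.2)
        ((measurable_outputPDF P v).comp measurable_snd) htm]
    congr 1
    ext z
    exact (ENNReal.mul_div_cancel (outputPDF_ne_zero hv _) (outputPDF_ne_top _ _)).symm
  have hac : J ≪ N := hJN ▸ withDensity_absolutelyContinuous _ _
  have hrn : J.rnDeriv N =ᵐ[N] t := hJN ▸ Measure.rnDeriv_withDensity N htm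
  have htr (z : ℝ × ℝ) : (t z).toReal =
      gaussianPDFReal 0 v (z.2 - z.1) / (outputPDF P v z.2).toReal := by
    simp only [t, ENNReal.toReal_div, gaussianPDF,
      ENNReal.toReal_ofReal (gaussianPDFReal_nonneg _ _ _)]
  have htt (z : ℝ × ℝ) : t z ≠ ∞ :=
    ENNReal.div_ne_top (by simp [gaussianPDF]) (outputPDF_ne_zero hv _)
  have hatom : ∀ᵐ z ∂N, P {z.1} ≠ 0 := by
    refine Measure.quasiMeasurePreserving_fst.ae (p := fun x => P {x} ≠ 0) ?_
    have hms : MeasurableSet {x | P {x} = 0} := by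
      have : {x | P {x} = 0} = {x | P.real {x} = 0} := by
        ext x; simp [measureReal_eq_zero_iff]
      rw [this]
      exact measurable_real_singleton P (measurableSet_singleton 0)
    rw [ae_iff]
    simp only [ne_eq, not_not]
    rw [← lintegral_indicator_one hms, lintegral_eq_tsum_of_countable hs hP]
    simp only [ENNReal.tsum_eq_zero, mul_eq_zero]
    intro x
    by_cases hx : P {x} = 0 <;> simp [hx]
  have hsm := measurable_posteriorSurprise P v
  have hem : Measurable fun z : ℝ × ℝ => -Real.log (P.real {z.1}) :=
    ((measurable_real_singleton P).comp measurable_fst).log.neg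
  have hI : InformationTheory.klDiv J N =
      ∫⁻ z, ENNReal.ofReal (InformationTheory.klFun (t z).toReal) ∂N := by
    rw [InformationTheory.klDiv_eq_lintegral_klFun_of_ac hac]
    refine lintegral_congr_ae ?_
    filter_upwards [hrn] with z hz
    rw [hz]
  have hR : equivocation P v =
      ∫⁻ z, t z * ENNReal.ofReal (posteriorSurprise P v z.1 z.2) ∂N := by
    have h1 := lintegral_withDensity_eq_lintegral_mul N htm hsm.ennreal_ofReal
    simp only [Pi.mul_apply] at h1
    rw [← h1, ← hJN, hJ, map_input_output P hv,
      lintegral_withDensity_eq_lintegral_mul _ (measurable_gaussianPDF_sub v) hsm.ennreal_ofReal,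
      lintegral_prod _ ((measurable_gaussianPDF_sub v).mul hsm.ennreal_ofReal).aemeasurable]
    simp only [Pi.mul_apply, gaussianPDF,
      ← ENNReal.ofReal_mul (gaussianPDFReal_nonneg _ _ _)]
    rfl
  have hE : entropy P = ∫⁻ z, t z * ENNReal.ofReal (-Real.log (P.real {z.1})) ∂N := by
    have h1 := lintegral_withDensity_eq_lintegral_mul N htm hem.ennreal_ofReal
    simp only [Pi.mul_apply] at h1
    rw [← h1, ← hJN, hJ, lintegral_map hem.ennreal_ofReal hm]
    have h2 := lintegral_map (μ := P.prod (gaussianReal 0 v))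
      (f := fun x => ENNReal.ofReal (-Real.log (P.real {x})))
      (measurable_real_singleton P).log.neg.ennreal_ofReal measurable_fst
    rw [hfst] at h2
    rw [← h2, lintegral_eq_tsum_of_countable hs hP, entropy, if_pos ⟨s, hs, hP⟩]
    refine tsum_congr fun x => ?_
    rw [← ENNReal.ofReal_toReal (measure_ne_top P {x}), ← ENNReal.ofReal_mul' (by positivity),
      Real.negMulLog, Measure.real]
    congr 1
    ring
  have ht1 : ∫⁻ z, t z ∂N = 1 := by
    rw [← setLIntegral_univ, ← withDensity_apply _ MeasurableSet.univ, ← hJN, measure_univ]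
  -- Pointwise this is `klFun t = t log t + 1 - t` combined with surprise `-log p - log t`. Moving
  -- `t` to the left leaves only nonnegative terms, so the identity integrates even when the entropy
  -- is infinite.
  have key : ∫⁻ z, (ENNReal.ofReal (InformationTheory.klFun (t z).toReal) +
      t z * ENNReal.ofReal (posteriorSurprise P v z.1 z.2) + t z) ∂N =
      ∫⁻ z, (t z * ENNReal.ofReal (-Real.log (P.real {z.1})) + 1) ∂N := by
    refine lintegral_congr_ae ?_
    filter_upwards [hatom] with z hz
    have hs0 := posteriorSurprise_nonneg hv z.2 hz
    have hp0 : 0 < P.real {z.1} := ENNReal.toReal_pos hz (measure_ne_top _ _)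
    have he0 : 0 ≤ -Real.log (P.real {z.1}) :=
      neg_nonneg.2 (Real.log_nonpos hp0.le measureReal_le_one)
    have hk := InformationTheory.klFun_nonneg (x := (t z).toReal) ENNReal.toReal_nonneg
    have e : t z = ENNReal.ofReal (t z).toReal := (ENNReal.ofReal_toReal (htt z)).symm
    have ht0 : 0 ≤ (t z).toReal := ENNReal.toReal_nonneg
    set τ := (t z).toReal with hτ
    rw [e, ← ENNReal.ofReal_mul ht0, ← ENNReal.ofReal_mul ht0, ← ENNReal.ofReal_one,
      ← ENNReal.ofReal_add hk (by positivity), ← ENNReal.ofReal_add (by positivity) ht0,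
      ← ENNReal.ofReal_add (by positivity) zero_le_one]
    congr 1
    rw [posteriorSurprise, ← htr, ← hτ, InformationTheory.klFun_apply]
    ring
  rw [lintegral_add_right _ htm, lintegral_add_right _
    (g := fun z => t z * ENNReal.ofReal (posteriorSurprise P v z.1 z.2))
    (htm.mul hsm.ennreal_ofReal), ← hI, ← hR,
    lintegral_add_right _ measurable_const, ← hE, ht1, lintegral_one, measure_univ] at key
  exact (ENNReal.add_left_inj ENNReal.one_ne_top).1 key

end OutputPDF

/-! ### Lower and upper bounds on the equivocation -/

theorem gaussianPDFReal_inv_snr {snr : ℝ} (hsnr : 0 < snr) (z : ℝ) :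
    gaussianPDFReal 0 (1 / snr).toNNReal z =
      √(snr / (2 * Real.pi)) * Real.exp (-(snr * (z ^ 2 / 2))) := by
  rw [gaussianPDFReal, Real.coe_toNNReal _ (by positivity), ← Real.sqrt_inv]
  congr 2
  · field_simp
  · field_simp
    simp

/-- The parallelogram law, `((y - s)² + (y - t)²) / 4 = (y - (s + t) / 2)² / 2 + (s - t)² / 8`. This
is where the exponent `d² / 8` comes from. -/
theorem sqrt_gaussianPDFReal_mul {snr : ℝ} (hsnr : 0 < snr) (y s t : ℝ) :
    √(gaussianPDFReal 0 (1 / snr).toNNReal (y - s) * gaussianPDFReal 0 (1 / snr).toNNReal (y - t)) =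
      Real.exp (-(snr * ((s - t) ^ 2 / 8))) *
        gaussianPDFReal 0 (1 / snr).toNNReal (y - (s + t) / 2) := by
  rw [Real.sqrt_eq_iff_mul_self_eq (mul_nonneg (gaussianPDFReal_nonneg _ _ _)
    (gaussianPDFReal_nonneg _ _ _)) (mul_nonneg (Real.exp_pos _).le (gaussianPDFReal_nonneg _ _ _))]
  simp only [gaussianPDFReal_inv_snr hsnr]
  have e : Real.exp (-(snr * ((s - t) ^ 2 / 8))) * Real.exp (-(snr * ((s - t) ^ 2 / 8))) *
      (Real.exp (-(snr * ((y - (s + t) / 2) ^ 2 / 2))) *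
        Real.exp (-(snr * ((y - (s + t) / 2) ^ 2 / 2)))) =
      Real.exp (-(snr * ((y - s) ^ 2 / 2))) * Real.exp (-(snr * ((y - t) ^ 2 / 2))) := by
    simp only [← Real.exp_add]
    congr 1
    ring
  linear_combination (-√(snr / (2 * Real.pi)) * √(snr / (2 * Real.pi))) * e

theorem lintegral_sqrt_gaussianPDFReal_mul {snr : ℝ} (hsnr : 0 < snr) (s t : ℝ) :
    ∫⁻ y, ENNReal.ofReal √(gaussianPDFReal 0 (1 / snr).toNNReal (y - s) *
      gaussianPDFReal 0 (1 / snr).toNNReal (y - t)) =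
      ENNReal.ofReal (Real.exp (-(snr * ((s - t) ^ 2 / 8)))) := by
  have hv : (1 / snr).toNNReal ≠ 0 := (Real.toNNReal_pos.2 (by positivity)).ne'
  simp only [sqrt_gaussianPDFReal_mul hsnr, ENNReal.ofReal_mul (Real.exp_pos _).le]
  rw [lintegral_const_mul' _ _ ENNReal.ofReal_ne_top, lintegral_sub_right_eq_self
    (fun y => ENNReal.ofReal (gaussianPDFReal 0 (1 / snr).toNNReal y)) ((s + t) / 2),
    lintegral_gaussianPDFReal_eq_one 0 hv, mul_one]

/-- Two atoms closer than `d` keep the equivocation above an exponential of exponent smaller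
than `d² / 8`. -/
theorem exists_exp_le_equivocation {P : Measure ℝ} [IsProbabilityMeasure P] {x y d : ℝ}
    (hx : P {x} ≠ 0) (hy : P {y} ≠ 0) (hxy : x < y) (hd : y - x < d) :
    ∃ c κ : ℝ, 0 < c ∧ κ < d ^ 2 / 8 ∧ ∀ snr : ℝ, 1 ≤ snr →
      ENNReal.ofReal (c * Real.exp (-(snr * κ))) ≤ equivocation P (1 / snr).toNNReal := by
  -- On the window from the midpoint of `x` and `y` to `x + e / 2`, the output is at least as likely
  -- under `y` as under `x`, so the surprise is at least `log (1 + q / p)`, while the noise density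
  -- is at least `K exp (-snr e² / 8)`. The window has a length independent of `snr`, and `e < d`
  -- yields the better exponent.
  obtain ⟨e, he1, he2⟩ := exists_between hd
  have hp : 0 < P.real {x} := ENNReal.toReal_pos hx (measure_ne_top _ _)
  have hq : 0 < P.real {y} := ENNReal.toReal_pos hy (measure_ne_top _ _)
  set p := P.real {x} with hpdef
  set q := P.real {y} with hqdef
  have hlog : 0 < Real.log (1 + q / p) := Real.log_pos (by linarith [div_pos hq hp])
  set K := √(1 / (2 * Real.pi)) with hK
  have hK0 : 0 < K := by positivity
  have hlen : 0 < (e - (y - x)) / 2 := by linarith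
  refine ⟨p * (K * Real.log (1 + q / p)) * ((e - (y - x)) / 2), e ^ 2 / 8, by positivity,
    by nlinarith, fun snr hsnr1 => ?_⟩
  have hsnr : 0 < snr := by linarith
  have hv : (1 / snr).toNNReal ≠ 0 := (Real.toNNReal_pos.2 (by positivity)).ne'
  set v := (1 / snr).toNNReal with hvdef
  have hpt : ∀ w ∈ Set.Icc (x + (y - x) / 2) (x + e / 2),
      K * Real.log (1 + q / p) * Real.exp (-(snr * (e ^ 2 / 8))) ≤
        gaussianPDFReal 0 v (w - x) * posteriorSurprise P v x w := by
    intro w hw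
    have hG := gaussianPDFReal_pos 0 v (w - x) hv
    have h1 : K * Real.exp (-(snr * (e ^ 2 / 8))) ≤ gaussianPDFReal 0 v (w - x) := by
      rw [gaussianPDFReal_inv_snr hsnr]
      have hw2 : (w - x) ^ 2 / 2 ≤ e ^ 2 / 8 := by nlinarith [hw.1, hw.2]
      have hK1 : K ≤ √(snr / (2 * Real.pi)) :=
        Real.sqrt_le_sqrt (div_le_div_of_nonneg_right hsnr1 (by positivity))
      gcongr
    have h2 : gaussianPDFReal 0 v (w - x) ≤ gaussianPDFReal 0 v (w - y) := by
      rw [gaussianPDFReal_inv_snr hsnr, gaussianPDFReal_inv_snr hsnr]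
      have hw2 : (w - y) ^ 2 / 2 ≤ (w - x) ^ 2 / 2 := by nlinarith [hw.1, hw.2]
      gcongr
    have h3 : Real.log (1 + q / p) ≤ posteriorSurprise P v x w := by
      rw [posteriorSurprise_eq_log hv w hx]
      refine Real.log_le_log (by positivity) ?_
      rw [le_div_iff₀ (by positivity)]
      have h4 := sum_le_outputPDF (P := P) v w {x, y}
      rw [Finset.sum_pair hxy.ne, ← hpdef, ← hqdef] at h4
      have h5 : (1 + q / p) * (p * gaussianPDFReal 0 v (w - x)) =
          p * gaussianPDFReal 0 v (w - x) + q * gaussianPDFReal 0 v (w - x) := by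
        field_simp
      rw [h5]
      nlinarith
    calc K * Real.log (1 + q / p) * Real.exp (-(snr * (e ^ 2 / 8)))
        = K * Real.exp (-(snr * (e ^ 2 / 8))) * Real.log (1 + q / p) := by ring
      _ ≤ _ := mul_le_mul h1 h3 hlog.le hG.le
  have hinner : ENNReal.ofReal (K * Real.log (1 + q / p) * Real.exp (-(snr * (e ^ 2 / 8)))) *
      ENNReal.ofReal ((e - (y - x)) / 2) ≤
      ∫⁻ w, ENNReal.ofReal (gaussianPDFReal 0 v (w - x) * posteriorSurprise P v x w) := by
    have hvol : volume (Set.Icc (x + (y - x) / 2) (x + e / 2)) =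
        ENNReal.ofReal ((e - (y - x)) / 2) := by
      rw [Real.volume_Icc]; congr 1; ring
    rw [← hvol, ← setLIntegral_const]
    exact (setLIntegral_mono' measurableSet_Icc fun w hw =>
      ENNReal.ofReal_le_ofReal (hpt w hw)).trans (setLIntegral_le_lintegral _ _)
  have houter : (∫⁻ w, ENNReal.ofReal (gaussianPDFReal 0 v (w - x) * posteriorSurprise P v x w)) *
      P {x} ≤ equivocation P v := by
    rw [equivocation, ← lintegral_singleton (μ := P) (fun x =>
      ∫⁻ w, ENNReal.ofReal (gaussianPDFReal 0 v (w - x) * posteriorSurprise P v x w)) x]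
    exact setLIntegral_le_lintegral _ _
  refine le_trans (le_of_eq ?_) ((mul_le_mul_left hinner (P {x})).trans houter)
  rw [← ENNReal.ofReal_toReal (measure_ne_top P {x}), ← ENNReal.ofReal_mul (by positivity),
    ← ENNReal.ofReal_mul (by positivity)]
  congr 1
  change _ = _ * p
  ring

theorem tsum_mul_self_le {ι : Type*} (f : ι → ℝ≥0∞) :
    ∑' i, f i * f i ≤ (∑' i, f i) * ∑' i, f i := by
  rw [← ENNReal.tsum_mul_right]
  exact ENNReal.tsum_le_tsum fun i => by gcongr; exact ENNReal.le_tsum i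

/-- The hypothesis gives `f / a ≤ (1 + σ / √a)²`, and then `log (1 + x) ≤ x`. The bound is linear in
`σ`, so when `σ` is a sum of square roots it splits into pairwise overlaps. -/
theorem mul_log_le_two_mul_sqrt {a σ f : ℝ} (ha : 0 < a) (hσ : 0 ≤ σ) (hf : 0 < f)
    (h : f ≤ a + σ * σ) : a * Real.log (f / a) ≤ 2 * (√a * σ) := by
  have hs : 0 < √a := Real.sqrt_pos.2 ha
  have hsq : √a * √a = a := Real.mul_self_sqrt ha.le
  have h1 : f / a ≤ (1 + σ / √a) ^ 2 := by
    rw [div_le_iff₀ ha]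
    have : (1 + σ / √a) ^ 2 * a = a + σ * σ + 2 * (σ * √a) := by
      have e : (1 + σ / √a) ^ 2 * (√a * √a) = (√a + σ) ^ 2 := by field_simp
      rw [hsq] at e
      linear_combination e + hsq
    rw [this]
    nlinarith [mul_nonneg hσ hs.le]
  have h2 : Real.log (f / a) ≤ 2 * (σ / √a) := by
    refine (Real.log_le_log (by positivity) h1).trans ?_
    rw [Real.log_pow]
    have := Real.log_le_sub_one_of_pos (x := 1 + σ / √a) (by positivity)
    push_cast
    linarith
  calc a * Real.log (f / a) ≤ a * (2 * (σ / √a)) := by gcongr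
    _ = 2 * (√a * σ) := by
      nth_rewrite 1 [← hsq]; field_simp

/-- The square roots are again Gaussian weights, with parameter `l / 2`. Their sum makes the
constant in the equivocation bound finite. -/
theorem summable_sqrt_discreteGaussianMass {l : ℝ} (hl : 0 < l) :
    Summable fun i => √(discreteGaussianMass l i) := by
  refine ((summable_exp_neg_mul_sq (l := l / 2) (by positivity)).mul_left
    (Real.exp (-logTheta l / 2))).congr fun i => ?_
  rw [← Real.exp_add, discreteGaussianMass, ← Real.exp_half]
  congr 1
  ring

/-- The equivocation of a discrete Gaussian law on `β ℤ` is `O (exp (- snr β² / 8))`. -/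
theorem equivocation_discreteGaussian_le {β l snr : ℝ} (hβ : β ≠ 0) (hl : 0 < l) (hsnr : 0 < snr) :
    equivocation (discreteGaussian β l) (1 / snr).toNNReal ≤
      ENNReal.ofReal (2 * (∑' i, √(discreteGaussianMass l i)) ^ 2 *
        Real.exp (-(snr * (β ^ 2 / 8)))) := by
  have := isProbabilityMeasure_discreteGaussian (β := β) hl
  have hv : (1 / snr).toNNReal ≠ 0 := (Real.toNNReal_pos.2 (by positivity)).ne'
  set v := (1 / snr).toNNReal with hvdef
  set q := discreteGaussianMass l with hq
  have hq0 (i : ℤ) : 0 < q i := discreteGaussianMass_pos l i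
  set G : ℤ → ℝ → ℝ := fun i y => gaussianPDFReal 0 v (y - β * i) with hGdef
  have hG0 (i : ℤ) (y : ℝ) : 0 < G i y := gaussianPDFReal_pos _ _ _ hv
  have ha0 (i : ℤ) (y : ℝ) : 0 < q i * G i y := mul_pos (hq0 i) (hG0 i y)
  have hF (y : ℝ) : outputPDF (discreteGaussian β l) v y = ∑' j, ENNReal.ofReal (q j * G j y) := by
    rw [outputPDF, lintegral_discreteGaussian]
    refine tsum_congr fun j => ?_
    rw [ENNReal.ofReal_mul (hq0 j).le]
    rfl
  have hatom (i : ℤ) : (discreteGaussian β l).real {β * (i : ℝ)} = q i := by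
    rw [Measure.real, discreteGaussian_singleton hβ, ENNReal.toReal_ofReal (hq0 i).le]
  -- The output density is `a + ∑_{j ≠ i} q_j G_j ≤ a + S²` with `S` the sum of the square roots, so
  -- the surprise weighted by `a` is at most `2 √a S`. Integrating each product gives the overlap of
  -- two Gaussians.
  have hpt (i : ℤ) (y : ℝ) : ENNReal.ofReal (q i) *
      ENNReal.ofReal (G i y * posteriorSurprise (discreteGaussian β l) v (β * i) y) ≤
      2 * ∑' j, if j = i then 0 else ENNReal.ofReal √(q i * G i y) *
        ENNReal.ofReal √(q j * G j y) := by
    have hne : discreteGaussian β l {β * (i : ℝ)} ≠ 0 := by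
      rw [discreteGaussian_singleton hβ]
      exact (ENNReal.ofReal_pos.2 (hq0 i)).ne'
    rw [← ENNReal.ofReal_mul (hq0 i).le, posteriorSurprise_eq_log hv y hne, hatom, ← mul_assoc]
    set a := q i * G i y with ha
    have hapos : 0 < a := ha0 i y
    set S : ℝ≥0∞ := ∑' j, if j = i then 0 else ENNReal.ofReal √(q j * G j y) with hS
    have hright : (∑' j, if j = i then 0 else ENNReal.ofReal √a * ENNReal.ofReal √(q j * G j y)) =
        ENNReal.ofReal √a * S := by
      rw [hS, ← ENNReal.tsum_mul_left]
      refine tsum_congr fun j => ?_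
      split_ifs <;> simp
    rw [hright]
    by_cases hStop : S = ∞
    · rw [hStop, ENNReal.mul_top (ENNReal.ofReal_pos.2 (Real.sqrt_pos.2 hapos)).ne',
        ENNReal.mul_top (by norm_num)]
      exact le_top
    have hSr : S = ENNReal.ofReal S.toReal := (ENNReal.ofReal_toReal hStop).symm
    have hσ : 0 ≤ S.toReal := ENNReal.toReal_nonneg
    have hFle : outputPDF (discreteGaussian β l) v y ≤
        ENNReal.ofReal (a + S.toReal * S.toReal) := by
      rw [hF, ENNReal.tsum_eq_add_tsum_ite i, ENNReal.ofReal_add hapos.le (by positivity),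
        ENNReal.ofReal_mul hσ, ← hSr]
      gcongr
      refine le_trans (le_of_eq (tsum_congr fun j => ?_)) (tsum_mul_self_le _)
      split_ifs
      · simp
      · rw [← ENNReal.ofReal_mul (Real.sqrt_nonneg _), Real.mul_self_sqrt (ha0 j y).le]
    have hfle : (outputPDF (discreteGaussian β l) v y).toReal ≤ a + S.toReal * S.toReal :=
      ENNReal.toReal_le_of_le_ofReal (by positivity) hFle
    rw [hSr, ← ENNReal.ofReal_mul (Real.sqrt_nonneg _), ← ENNReal.ofReal_ofNat,
      ← ENNReal.ofReal_mul zero_le_two]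
    exact ENNReal.ofReal_le_ofReal
      (mul_log_le_two_mul_sqrt hapos hσ (outputPDF_toReal_pos hv y) hfle)
  set E := Real.exp (-(snr * (β ^ 2 / 8))) with hE
  have hGm (i : ℤ) : Measurable (G i) :=
    (measurable_gaussianPDFReal 0 v).comp (measurable_id.sub measurable_const)
  have hinner (i : ℤ) : ENNReal.ofReal (q i) * ∫⁻ y, ENNReal.ofReal
      (gaussianPDFReal 0 v (y - β * i) * posteriorSurprise (discreteGaussian β l) v (β * i) y) ≤
      2 * ∑' j, ENNReal.ofReal √(q i) * ENNReal.ofReal √(q j) * ENNReal.ofReal E := by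
    rw [← lintegral_const_mul' _ _ ENNReal.ofReal_ne_top]
    refine (lintegral_mono (hpt i)).trans ?_
    rw [lintegral_const_mul' _ _ (by norm_num), lintegral_tsum]
    · gcongr with j
      split_ifs with hji
      · simp
      · have e (y : ℝ) : ENNReal.ofReal √(q i * G i y) * ENNReal.ofReal √(q j * G j y) =
            ENNReal.ofReal √(q i) * ENNReal.ofReal √(q j) *
              ENNReal.ofReal √(G i y * G j y) := by
          rw [← ENNReal.ofReal_mul (Real.sqrt_nonneg _), ← ENNReal.ofReal_mul (Real.sqrt_nonneg _),
            ← ENNReal.ofReal_mul (by positivity), Real.sqrt_mul (hq0 i).le,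
            Real.sqrt_mul (hq0 j).le, Real.sqrt_mul (hG0 i y).le]
          congr 1
          ring
        simp only [e]
        rw [lintegral_const_mul' _ _ (by finiteness), lintegral_sqrt_gaussianPDFReal_mul hsnr]
        gcongr
        refine Real.exp_le_exp.2 (neg_le_neg ?_)
        -- Distinct lattice points are at least `|β|` apart, so the nearest-neighbour overlap
        -- dominates every pair.
        have hij : (1 : ℝ) ≤ ((i : ℝ) - j) ^ 2 := by
          have : (1 : ℤ) ≤ (i - j) ^ 2 := by
            have := sq_nonneg (i - j)
            have := pow_ne_zero 2 (sub_ne_zero.2 (Ne.symm hji))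
            omega
          exact_mod_cast this
        have : β ^ 2 ≤ (β * i - β * j) ^ 2 := by nlinarith [sq_nonneg β]
        gcongr
    · intro j
      split_ifs
      · exact aemeasurable_const
      · exact (((measurable_const.mul (hGm i)).sqrt.ennreal_ofReal).mul
          ((measurable_const.mul (hGm j)).sqrt.ennreal_ofReal)).aemeasurable
  rw [equivocation, lintegral_discreteGaussian]
  refine (ENNReal.tsum_le_tsum hinner).trans (le_of_eq ?_)
  simp only [ENNReal.tsum_mul_left, ENNReal.tsum_mul_right]
  rw [← ENNReal.ofReal_tsum_of_nonneg (fun i => Real.sqrt_nonneg _)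
    (summable_sqrt_discreteGaussianMass hl)]
  change 2 * (ENNReal.ofReal (∑' i, √(q i)) * ENNReal.ofReal (∑' i, √(q i)) * _) = _
  have hT : 0 ≤ ∑' i, √(q i) := tsum_nonneg fun i => Real.sqrt_nonneg _
  rw [← ENNReal.ofReal_mul hT, ← ENNReal.ofReal_mul (mul_nonneg hT hT), ← ENNReal.ofReal_ofNat,
    ← ENNReal.ofReal_mul zero_le_two]
  congr 1
  ring

/-! ### Optimality at high snr and the capacity asymptotics -/

theorem exists_countable_of_entropy_ne_top {P : Measure ℝ} (h : entropy P ≠ ∞) :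
    ∃ s : Set ℝ, s.Countable ∧ P sᶜ = 0 := by
  by_contra hc
  exact h (by rw [entropy, if_neg hc])

theorem gaussianChannelInfo_le_of_mem_inputsLE {P : Measure ℝ} {h snr : ℝ} (hP : P ∈ inputsLE h)
    (hsnr : 0 < snr) : gaussianChannelInfo snr P ≤ ENNReal.ofReal h := by
  obtain ⟨hprob, -, hent⟩ := hP
  obtain ⟨s, hs, hs0⟩ :=
    exists_countable_of_entropy_ne_top (ne_top_of_le_ne_top ENNReal.ofReal_ne_top hent)
  exact (le_self_add.trans_eq (gaussianChannelInfo_add_equivocation hs hs0 hsnr)).trans hent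

theorem inputsEq_subset_inputsLE (h : ℝ) : inputsEq h ⊆ inputsLE h :=
  fun _ hP => ⟨hP.1, hP.2.1.le, hP.2.2.le⟩

theorem tendsto_exp_neg_mul_atTop {b : ℝ} (hb : 0 < b) :
    Tendsto (fun snr : ℝ => Real.exp (-(snr * b))) atTop (nhds 0) :=
  Real.tendsto_exp_neg_atTop_nhds_zero.comp (tendsto_id.atTop_mul_const hb)

section Optimality

variable {h l d : ℝ}

theorem discreteGaussian_mem_inputsEq (hl : 0 < l) (hd : 0 < d)
    (hd2 : d ^ 2 * -deriv logTheta l = 1) (hh : h = logTheta l - l * deriv logTheta l) :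
    discreteGaussian d l ∈ inputsEq h :=
  ⟨isProbabilityMeasure_discreteGaussian hl, secondMoment_discreteGaussian hl hd2,
    hh ▸ entropy_discreteGaussian hd.ne' hl⟩

/-- The discrete Gaussian law eventually beats every other input. -/
theorem eventually_gaussianChannelInfo_lt (hl : 0 < l) (hd : 0 < d)
    (hd2 : d ^ 2 * -deriv logTheta l = 1) (hh : h = logTheta l - l * deriv logTheta l)
    {P : Measure ℝ} (hP : P ∈ inputsLE h) (hne : P ≠ discreteGaussian d l) :
    ∀ᶠ snr in atTop, gaussianChannelInfo snr P < gaussianChannelInfo snr (discreteGaussian d l) := by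
  obtain ⟨hprob, hmom, hent⟩ := hP
  have hX := discreteGaussian_mem_inputsEq hl hd hd2 hh
  have hXprob := hX.1
  have hentX := hX.2.2
  have hent_top : entropy P ≠ ∞ := ne_top_of_le_ne_top ENNReal.ofReal_ne_top hent
  obtain ⟨s, hs, hs0⟩ := exists_countable_of_entropy_ne_top hent_top
  set X := discreteGaussian d l with hXdef
  suffices H : ∀ᶠ snr : ℝ in atTop, entropy P + equivocation X (1 / snr).toNNReal <
      ENNReal.ofReal h + equivocation P (1 / snr).toNNReal by
    filter_upwards [H, eventually_gt_atTop 0] with snr H hsnr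
    rw [← hentX, ← gaussianChannelInfo_add_equivocation hs hs0 hsnr,
      ← gaussianChannelInfo_add_equivocation (Set.countable_range _)
        (discreteGaussian_compl_range d l) hsnr, add_assoc, add_assoc,
      add_comm (equivocation X _)] at H
    exact lt_of_add_lt_add_right H
  set C := 2 * (∑' i, √(discreteGaussianMass l i)) ^ 2 with hC
  have hC0 : 0 ≤ C := by positivity
  have hupper : ∀ snr : ℝ, 0 < snr → equivocation X (1 / snr).toNNReal ≤
      ENNReal.ofReal (C * Real.exp (-(snr * (d ^ 2 / 8)))) :=
    fun snr hsnr => equivocation_discreteGaussian_le hd.ne' hl hsnr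
  -- With smaller entropy, a fixed gap beats the vanishing equivocation of the discrete Gaussian
  -- law. With equal entropy, uniqueness of the maximizer provides two atoms closer than `d`, and
  -- the exponents decide.
  rcases hent.lt_or_eq with hlt | heq
  · obtain ⟨η, hη⟩ : ∃ η, η = (entropy P).toReal := ⟨_, rfl⟩
    have hη0 : 0 ≤ η := hη ▸ ENNReal.toReal_nonneg
    have hPη : entropy P = ENNReal.ofReal η := by rw [hη, ENNReal.ofReal_toReal hent_top]
    have hηh : η < h := by
      rw [hPη] at hlt
      exact (ENNReal.ofReal_lt_ofReal_iff_of_nonneg hη0).1 hlt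
    have ht := ((tendsto_exp_neg_mul_atTop (b := d ^ 2 / 8) (by positivity)).const_mul C).const_add η
    rw [mul_zero, add_zero] at ht
    filter_upwards [ht.eventually (gt_mem_nhds hηh), eventually_gt_atTop 0] with snr h1 hsnr
    calc entropy P + equivocation X (1 / snr).toNNReal
        ≤ ENNReal.ofReal η + ENNReal.ofReal (C * Real.exp (-(snr * (d ^ 2 / 8)))) := by
          rw [hPη]; gcongr; exact hupper snr hsnr
      _ = ENNReal.ofReal (η + C * Real.exp (-(snr * (d ^ 2 / 8)))) :=
          (ENNReal.ofReal_add hη0 (by positivity)).symm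
      _ < ENNReal.ofReal h := (ENNReal.ofReal_lt_ofReal_iff (hη0.trans_lt hηh)).2 h1
      _ ≤ _ := le_self_add
  · have hclose : ∃ x y : ℝ, P {x} ≠ 0 ∧ P {y} ≠ 0 ∧ x < y ∧ y - x < d := by
      by_contra! hsep
      refine hne (eq_discreteGaussian_of_separated hl hd hd2 hh heq hmom ?_)
      intro x y hx hy hxy
      rcases hxy.lt_or_gt with hxy | hxy
      · rw [abs_sub_comm, abs_of_pos (sub_pos.2 hxy)]
        exact hsep x y hx hy hxy
      · rw [abs_of_pos (sub_pos.2 hxy)]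
        exact hsep y x hy hx hxy
    obtain ⟨x, y, hx, hy, hxy, hxyd⟩ := hclose
    obtain ⟨c, κ, hc, hκ, hlower⟩ := exists_exp_le_equivocation hx hy hxy hxyd
    have ht := (tendsto_exp_neg_mul_atTop (sub_pos.2 hκ)).const_mul C
    rw [mul_zero] at ht
    filter_upwards [ht.eventually (gt_mem_nhds hc), eventually_ge_atTop 1] with snr h1 hsnr
    rw [heq]
    refine ENNReal.add_lt_add_left ENNReal.ofReal_ne_top ?_
    refine (hupper snr (by linarith)).trans_lt (lt_of_lt_of_le ?_ (hlower snr hsnr))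
    rw [ENNReal.ofReal_lt_ofReal_iff (by positivity)]
    have e : Real.exp (-(snr * (d ^ 2 / 8))) =
        Real.exp (-(snr * (d ^ 2 / 8 - κ))) * Real.exp (-(snr * κ)) := by
      rw [← Real.exp_add]; congr 1; ring
    rw [e, ← mul_assoc]
    exact mul_lt_mul_of_pos_right h1 (Real.exp_pos _)

/-- The strict eventual win over all of `inputsLE h` settles every subclass containing the discrete
Gaussian law, hence both classes of the theorem. -/
theorem isOptimalAtHighSNR_iff (hl : 0 < l) (hd : 0 < d)
    (hd2 : d ^ 2 * -deriv logTheta l = 1) (hh : h = logTheta l - l * deriv logTheta l)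
    {S : Set (Measure ℝ)} (hS : S ⊆ inputsLE h) (hX : discreteGaussian d l ∈ S) (Q : Measure ℝ) :
    IsOptimalAtHighSNR S Q ↔ Q = discreteGaussian d l := by
  constructor
  · rintro ⟨hQ, hopt⟩
    by_contra hne
    obtain ⟨snr₀, -, h0⟩ := hopt _ hX
    obtain ⟨snr, h1, h2⟩ := ((eventually_gaussianChannelInfo_lt hl hd hd2 hh (hS hQ) hne).and
      (eventually_gt_atTop snr₀)).exists
    exact absurd (h0 snr h2) (not_le.2 h1)
  · rintro rfl
    refine ⟨hX, fun P hP => ?_⟩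
    by_cases hne : P = discreteGaussian d l
    · exact ⟨1, one_pos, fun snr _ => by rw [hne]⟩
    · obtain ⟨a, ha⟩ := eventually_atTop.1
        (eventually_gaussianChannelInfo_lt hl hd hd2 hh (hS hP) hne)
      exact ⟨max a 1, by positivity, fun snr hsnr =>
        (ha snr ((le_max_left _ _).trans hsnr.le)).le⟩

/-- The capacity is at most `h`, and at least `h` minus the equivocation of the discrete Gaussian
law. -/
theorem sub_entropyCapacity_isBigO (hl : 0 < l) (hd : 0 < d)
    (hd2 : d ^ 2 * -deriv logTheta l = 1) (hh : h = logTheta l - l * deriv logTheta l)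
    (hh0 : 0 ≤ h) :
    (fun snr : ℝ => h - (entropyCapacity h snr).toReal)
      =O[atTop] (fun snr : ℝ => Real.exp (-(snr * (d ^ 2 / 8)))) := by
  have hX := discreteGaussian_mem_inputsEq hl hd hd2 hh
  have hXprob := hX.1
  set C := 2 * (∑' i, √(discreteGaussianMass l i)) ^ 2 with hC
  have hC0 : 0 ≤ C := by positivity
  refine IsBigO.of_bound C ?_
  filter_upwards [eventually_gt_atTop 0] with snr hsnr
  have hcap : entropyCapacity h snr ≤ ENNReal.ofReal h :=
    iSup₂_le fun P hP => gaussianChannelInfo_le_of_mem_inputsLE hP hsnr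
  have hcap_top : entropyCapacity h snr ≠ ∞ := ne_top_of_le_ne_top ENNReal.ofReal_ne_top hcap
  have hge : gaussianChannelInfo snr (discreteGaussian d l) ≤ entropyCapacity h snr :=
    le_iSup₂ (f := fun P (_ : P ∈ inputsLE h) => gaussianChannelInfo snr P) _
      (inputsEq_subset_inputsLE h hX)
  have h1 : ENNReal.ofReal h ≤ entropyCapacity h snr +
      ENNReal.ofReal (C * Real.exp (-(snr * (d ^ 2 / 8)))) := by
    rw [← hX.2.2, ← gaussianChannelInfo_add_equivocation (Set.countable_range _)
      (discreteGaussian_compl_range d l) hsnr]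
    gcongr
    exact equivocation_discreteGaussian_le hd.ne' hl hsnr
  have h2 : (entropyCapacity h snr).toReal ≤ h := ENNReal.toReal_le_of_le_ofReal hh0 hcap
  have h3 : h ≤ (entropyCapacity h snr).toReal + C * Real.exp (-(snr * (d ^ 2 / 8))) := by
    rw [← ENNReal.ofReal_toReal hcap_top, ← ENNReal.ofReal_add ENNReal.toReal_nonneg
      (by positivity)] at h1
    exact (ENNReal.ofReal_le_ofReal_iff (by positivity)).1 h1
  rw [Real.norm_of_nonneg (by linarith), Real.norm_of_nonneg (Real.exp_pos _).le]
  linarith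

end Optimality

theorem theorem1 (h : ℝ) (hh : 0 < h) :
    (∀ l : ℝ, 0 < l →
      Summable (fun j : ℤ => Real.exp (-l * (j : ℝ) ^ 2)) ∧
      DifferentiableAt ℝ logTheta l ∧ deriv logTheta l < 0) ∧
    ∃ l : ℝ, 0 < l ∧ h = logTheta l - l * deriv logTheta l ∧
      (∀ l' : ℝ, 0 < l' → h = logTheta l' - l' * deriv logTheta l' → l' = l) ∧
      ∃ d : ℝ, d = 1 / Real.sqrt (-deriv logTheta l) ∧
        (∀ Q : Measure ℝ,
          IsOptimalAtHighSNR (inputsEq h) Q ↔ Q = discreteGaussian d l) ∧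
        (∀ Q : Measure ℝ,
          IsOptimalAtHighSNR (inputsLE h) Q ↔ Q = discreteGaussian d l) ∧
        (fun snr : ℝ => h - (entropyCapacity h snr).toReal)
          =O[atTop] (fun snr : ℝ => Real.exp (-(snr * (d ^ 2 / 8)))) := by
  refine ⟨fun l hl => ⟨summable_exp_neg_mul_sq hl, (hasDerivAt_logTheta hl).differentiableAt,
    deriv_logTheta_neg hl⟩, ?_⟩
  obtain ⟨l, hl, hhl⟩ := exists_eq_logTheta_sub hh
  have hneg : 0 < -deriv logTheta l := neg_pos.2 (deriv_logTheta_neg hl)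
  have hd : 0 < 1 / Real.sqrt (-deriv logTheta l) := by positivity
  have hd2 : (1 / Real.sqrt (-deriv logTheta l)) ^ 2 * -deriv logTheta l = 1 := by
    rw [div_pow, Real.sq_sqrt hneg.le, one_pow, one_div_mul_cancel hneg.ne']
  have hX := discreteGaussian_mem_inputsEq hl hd hd2 hhl
  exact ⟨l, hl, hhl,
    fun l' hl' e => strictAntiOn_logTheta_sub.injOn hl' hl (e.symm.trans hhl), _, rfl,
    isOptimalAtHighSNR_iff hl hd hd2 hhl (inputsEq_subset_inputsLE h) hX,
    isOptimalAtHighSNR_iff hl hd hd2 hhl subset_rfl (inputsEq_subset_inputsLE h hX),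
    sub_entropyCapacity_isBigO hl hd hd2 hhl hh.le⟩
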